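/- **Setting.** A memoryless binary-input output-symmetric (MBIOS) channel has transition densities $p(z|0),p(z|1)$ with respect to a $\sigma$-finite reference measure $\mu$ on the output alphabet $\mathcal Z$ (counting measure for a discrete channel, so that the integrals below are sums), and there is a $\mu$-preserving measurable involution $\pi$ of $\mathcal Z$ with $p(z|1)=p(\pi(z)|0)$. Logarithms are in base 2. Let $\zeta=\int\sqrt{p(z|0)p(z|1)}\,d\mu(z)$ be the Bhattacharyya parameter, $C$ the Shannon capacity (the maximum of the mutual information over input distributions), $H(x)=-x\log x-(1-x)\log(1-x)$, and, for $0\le y\le 1$, $H^{-1}(y)$ the smaller root of $H(x)=y$. Gallager's random coding exponent is $$E_r(R)=\max_{0\le\rho\le1}\max_{Q}\,[E_0(\rho,Q)-\rho R],\qquad E_0(\rho,Q)=-\log\int\Big[\sum_{x\in\{0,1\}}Q(x)\,p(z|x)^{\frac1{1+\rho}}\Big]^{1+\rho}d\mu(z),$$ with $Q$ ranging over the distributions on $\{0,1\}$, and $$E_\zeta(R)=\begin{cases}H^{-1}(1-R)\,\log\frac1\zeta, & 0\le R\le 1-H\big(\frac{\zeta}{1+\zeta}\big),\\ E_r(R),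 & 1-H\big(\frac{\zeta}{1+\zeta}\big)< R\le C,\end{cases}$$ where $\log\frac1\zeta=+\infty$ if $\zeta=0$. **Codes.** Let $n\ge1$, $0\le k\le n$, $R=k/n$, $m=n-k=n(1-R)$. Given binary $m\times n$ matrices $H_1,H_2,\dots$, let $\mathbb H^t$ be the $mt\times nt$ block lower triangular Toeplitz matrix over $GF(2)$ with $(i,j)$ block $H_{i-j+1}$ for $j\le i\le t$. The time-invariant code $\mathbb H$ has the codebook $\{c\in GF(2)^{nt}:\mathbb H^tc=0\}$ up to each time $t$. A causal linear encoder for it is a family of matrices $G_{ij}\in GF(2)^{n\times k}$, $j\le i$, such that for each $t$ the map $(b_1,\dots,b_t)\mapsto(c_1,\dots,c_t)$, $c_i=\sum_{j\le i}G_{ij}b_j$, is a bijection from $(GF(2)^k)^t$ onto that codebook. At time $t$ a maximum likelihood decoder maps the channel outputs up to time $t$ to a message sequence $\hat b_{1|t},\dots,\hat b_{t|t}$ whose codeword has maximal likelihood (ties broken in any measurable way). For messages $b$ let $P^e_{t,d}(b)$ be the probability, over the channel, that $\min\{\tau:\hat b_{\tau|t}\ne b_\tau\}=t-d+1$. The code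 is *$(R,\beta,d_o)$-anytime reliable with constant $\eta$* if it has a causal linear encoder and, for each causal linear encoder of it and each choice of maximum likelihood decoders, $P^e_{t,d}(b)\le\eta\,2^{-n\beta d}$ for all message sequences $b$, all $t$ and all $d\ge d_o$. **Ensemble.** In $\mathbb{TZ}_{1/2}$, $H_1$ is any fixed matrix of full rank $m$, and the entries of $H_\tau$, $\tau\ge2$, are i.i.d. Bernoulli$(1/2)$. **Theorem.** For each MBIOS channel, each rate $0\le R<C$ and each real exponent $\beta<E_\zeta(R)$ there are $\eta>0$, $c>0$ and $D$, depending only on the channel, $R$ and $\beta$, such that for all $n\ge1$ and $k\geq 0$ with $k/n=R$, all full-rank $H_1\in GF(2)^{(n-k)\times n}$ and all $d_o\ge D$, the code $\mathbb H$ drawn from $\mathbb{TZ}_{1/2}$ satisfies $$P\big(\mathbb H\text{ is }(R,\beta,d_o)\text{-anytime reliable with constant }\eta\big)\ \ge\ 1-2^{-c\,n\,d_o}.$$ -/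

import Mathlib

open MeasureTheory

namespace AnytimeCodes

noncomputable section

/-! ## Memoryless binary-input output-symmetric channels -/

/-- A binary-input output-symmetric channel with output alphabet `Z`, given by its transition
densities `p x` (for `x ∈ GF(2)`) with respect to a σ-finite reference measure `μ`. For a discrete
channel `μ` is the counting measure and integrals are sums; for a real-valued output it may be
Lebesgue measure. Symmetry: an involution `flip` of the output alphabet, preserving `μ`,
exchanges the two conditional laws. -/
structure MBIOSChannel (Z : Type*) [MeasurableSpace Z] where
  μ : Measure Z
  sigmaFinite : SigmaFinite μ
  p : ZMod 2 → Z → ℝ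
  measurable_p : ∀ x, Measurable (p x)
  p_nonneg : ∀ x z, 0 ≤ p x z
  integral_p : ∀ x, ∫ z, p x z ∂μ = 1
  flip : Z → Z
  flip_flip : ∀ z, flip (flip z) = z
  measurePreserving_flip : MeasurePreserving flip μ μ
  p_one : ∀ z, p 1 z = p 0 (flip z)

namespace MBIOSChannel

variable {Z : Type*} [MeasurableSpace Z] (W : MBIOSChannel Z)

/-- The conditional law of one output symbol given the input `x`. -/
def law (x : ZMod 2) : Measure Z := W.μ.withDensity fun z => ENNReal.ofReal (W.p x z)

/-- The law of the outputs when the word `x` is sent (memoryless use of the channel). -/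
def outputLaw {ι : Type*} [Fintype ι] (x : ι → ZMod 2) : Measure (ι → Z) :=
  Measure.pi fun i => W.law (x i)

/-- The likelihood of the input word `x` given the outputs `z`. -/
def likelihood {ι : Type*} [Fintype ι] (z : ι → Z) (x : ι → ZMod 2) : ℝ :=
  ∏ i, W.p (x i) (z i)

/-- The Bhattacharyya parameter. -/
def zeta : ℝ := ∫ z, Real.sqrt (W.p 0 z * W.p 1 z) ∂W.μ

/-- Mutual information (in bits) between input and output for the input distribution `Q`. -/
def mutualInfo (Q : ZMod 2 → ℝ) : ℝ :=
  ∑ x, Q x * ∫ z, W.p x z * Real.logb 2 (W.p x z / ∑ y, Q y * W.p y z) ∂W.μ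

/-- The Shannon capacity (in bits per channel use). -/
def capacity : ℝ := sSup (W.mutualInfo '' stdSimplex ℝ (ZMod 2))

/-- Gallager's function `E₀(ρ, Q)`, in base 2. -/
def gallagerE0 (ρ : ℝ) (Q : ZMod 2 → ℝ) : ℝ :=
  -Real.logb 2 (∫ z, (∑ x, Q x * W.p x z ^ (1 / (1 + ρ))) ^ (1 + ρ) ∂W.μ)

/-- The random coding exponent `E_r(R)`: the maximum of `E₀(ρ, Q) - ρ R` over `0 ≤ ρ ≤ 1` and all
input distributions `Q`. -/
def randomCodingExponent (R : ℝ) : ℝ :=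
  sSup ((fun q : ℝ × (ZMod 2 → ℝ) => W.gallagerE0 q.1 q.2 - q.1 * R) ''
    (Set.Icc (0 : ℝ) 1 ×ˢ stdSimplex ℝ (ZMod 2)))

end MBIOSChannel

/-- The binary entropy function, in bits. -/
def H₂ (x : ℝ) : ℝ := Real.binEntropy x / Real.log 2

/-- For `y ∈ [0, 1]`, the smaller root of `H₂ x = y`. -/
def H₂inv (y : ℝ) : ℝ := sInf {x | x ∈ Set.Icc (0 : ℝ) 1 ∧ H₂ x = y}

/-- The exponent `E_ζ(R)`. It is extended-real valued because `log (1/ζ) = ∞` if `ζ = 0`. -/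
def MBIOSChannel.zetaExponent {Z : Type*} [MeasurableSpace Z] (W : MBIOSChannel Z) (R : ℝ) :
    EReal :=
  if R ≤ 1 - H₂ (W.zeta / (1 + W.zeta)) then
    (H₂inv (1 - R) : EReal) *
      (if W.zeta = 0 then ⊤ else ((Real.logb 2 (1 / W.zeta) : ℝ) : EReal))
  else (W.randomCodingExponent R : EReal)

/-! ## Causal linear codes

Time slots are numbered from `0`; up to time `t` the slots are indexed by `Fin t`, and a word of
`t` blocks of `n` bits is indexed by `Fin t × Fin n`. -/

section Codes

variable {m n k : ℕ}

/-- The leading `m t × n t` block of the Toeplitz parity check matrix built from the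
`m × n` blocks `H 0, H 1, …` (`H 0` is on the diagonal). -/
def toeplitz (H : ℕ → Fin m → Fin n → ZMod 2) (t : ℕ) :
    Matrix (Fin t × Fin m) (Fin t × Fin n) (ZMod 2) :=
  Matrix.of fun r s => if s.1 ≤ r.1 then H ((r.1 : ℕ) - (s.1 : ℕ)) r.2 s.2 else 0

/-- The code up to time `t`: the words satisfying all parity checks up to time `t`. -/
def code (H : ℕ → Fin m → Fin n → ZMod 2) (t : ℕ) : Set (Fin t × Fin n → ZMod 2) :=
  {c | Matrix.mulVec (toeplitz H t) c = 0}

/-- Causal linear encoding `c_i = ∑_{j ≤ i} G_{i j} b_j` of the messages `b_j ∈ GF(2)^k`. -/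
def encode (G : ℕ → ℕ → Matrix (Fin n) (Fin k) (ZMod 2)) (t : ℕ)
    (b : Fin t → Fin k → ZMod 2) : Fin t × Fin n → ZMod 2 :=
  fun r => ∑ j : Fin t, if j ≤ r.1 then Matrix.mulVec (G r.1 j) (b j) r.2 else 0

/-- `G` is a causal linear encoder of the code with parity checks `H`: at every time `t` it maps
the message sequences bijectively onto the code. -/
def IsEncoder (H : ℕ → Fin m → Fin n → ZMod 2)
    (G : ℕ → ℕ → Matrix (Fin n) (Fin k) (ZMod 2)) : Prop :=
  ∀ t, Set.BijOn (encode G t) Set.univ (code H t)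

variable {Z : Type*} [MeasurableSpace Z]

/-- Maximum likelihood decoding at time `t`; ties may be broken in any measurable way. -/
def IsMLDecoder (W : MBIOSChannel Z) {t : ℕ}
    (enc : (Fin t → Fin k → ZMod 2) → (Fin t × Fin n → ZMod 2))
    (dec : (Fin t × Fin n → Z) → (Fin t → Fin k → ZMod 2)) : Prop :=
  Measurable dec ∧ ∀ z b, W.likelihood z (enc b) ≤ W.likelihood z (enc (dec z))

/-- The earliest slot in which `b'` differs from `b` is `d` steps in the past, that is, it is the
slot `t - d + 1` of the slots `1, …, t` (which has the index `t - d` here). -/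
def EarliestErrorAt {t : ℕ} (d : ℕ) (b b' : Fin t → Fin k → ZMod 2) : Prop :=
  ∃ i : Fin t, (i : ℕ) + d = t ∧ b' i ≠ b i ∧ ∀ j < i, b' j = b j

/-- The probability `P_{t,d}^e`, over the channel, that the earliest decoding error is `d` steps in
the past when the messages `b` are sent. -/
def errorProb (W : MBIOSChannel Z) {t : ℕ}
    (enc : (Fin t → Fin k → ZMod 2) → (Fin t × Fin n → ZMod 2))
    (dec : (Fin t × Fin n → Z) → (Fin t → Fin k → ZMod 2)) (d : ℕ)
    (b : Fin t → Fin k → ZMod 2) : ℝ :=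
  (W.outputLaw (enc b)).real {z | EarliestErrorAt d b (dec z)}

/-- `(k/n, β, d₀)`-anytime reliability, with constant `η`, of an encoder-decoder pair: for all
message sequences, `P_{t,d}^e ≤ η 2^{-nβd}` for all times `t` and delays `d ≥ d₀`. -/
def PairAnytimeReliable (W : MBIOSChannel Z)
    (enc : ∀ t, (Fin t → Fin k → ZMod 2) → (Fin t × Fin n → ZMod 2))
    (dec : ∀ t, (Fin t × Fin n → Z) → (Fin t → Fin k → ZMod 2)) (η β : ℝ) (d₀ : ℕ) : Prop :=
  ∀ t d : ℕ, d₀ ≤ d → ∀ b : Fin t → Fin k → ZMod 2,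
    errorProb W (enc t) (dec t) d b ≤ η * (2 : ℝ) ^ (-(n * β * d))

/-- `(k/n, β, d₀)`-anytime reliability, with constant `η`, of the causal linear code with Toeplitz
parity checks `H` under maximum likelihood decoding: the code has a causal linear encoder with `k`
message bits per time slot, and each such encoder is anytime reliable together with each maximum
likelihood decoder. -/
def AnytimeReliable (W : MBIOSChannel Z) (k : ℕ) (H : ℕ → Fin m → Fin n → ZMod 2)
    (η β : ℝ) (d₀ : ℕ) : Prop :=
  (∃ G : ℕ → ℕ → Matrix (Fin n) (Fin k) (ZMod 2), IsEncoder H G) ∧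
  ∀ G : ℕ → ℕ → Matrix (Fin n) (Fin k) (ZMod 2), IsEncoder H G →
    ∀ dec : ∀ t, (Fin t × Fin n → Z) → (Fin t → Fin k → ZMod 2),
      (∀ t, IsMLDecoder W (encode G t) (dec t)) →
        PairAnytimeReliable W (encode G) dec η β d₀

/-- The ensemble `TZ_p`: the first block is the fixed matrix `H1`, and the entries of all later
blocks are i.i.d. Bernoulli(`p`). -/
def TZ (p : unitInterval) (H1 : Fin m → Fin n → ZMod 2) :
    Measure (ℕ → Fin m → Fin n → ZMod 2) :=
  Measure.infinitePi fun τ =>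
    if τ = 0 then Measure.dirac H1
    else Measure.pi fun _ => Measure.pi fun _ => ProbabilityTheory.bernoulliMeasure 1 0 p

end Codes

end

end AnytimeCodes

namespace AnytimeCodes

noncomputable section

open ProbabilityTheory
open scoped ENNReal

/-! ## Product measures -/

/-! By linearity, the Toeplitz structure and output symmetry, decoding is studied as if the zero
word had been sent. If the earliest error lies `d` slots back, the difference between the decoded
and the sent word, restricted to the last `d` slots, belongs to `startingCode H d`. Gallager's
argument then gives `errorProb_le_gallagerBound`: the error probability is at most a quantity
depending on `H`, `d` and `ρ` only, hence uniform in time, messages, encoder and decoder.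

Over the ensemble, a fixed word with nonzero first block passes all checks up to slot `d + 1` with
probability at most `2 ^ (-m d)`, because one nonzero coordinate of the first block feeds every
later syndrome with fresh uniform bits (`measure_mem_code_le`). First moments and Markov's
inequality now bound the probability that `gallagerBound` exceeds `2 ^ (-n β d)`.

At high rates, Jensen's inequality applied to the `ρ`-th power gives the exponent `E₀(ρ, uniform) -
ρ R`; symmetry and convexity show that no other input distribution does better. At low rates this
average is dominated by rare codes with words of small weight, so these are discarded. With `ρ = 1`
the bound is the sum of `ζ ^ weight`. For `x` slightly below `δ = H₂inv (1 - R)`, words of relative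
weight at most `x` exist with exponentially small probability, since `H₂ x < 1 - R`. The heavier
ones contribute about `2 ^ (-n d δ log (1/ζ))`, by a Chernoff tilting whose parameter is at least
`1` exactly when `ζ / (1 + ζ) ≤ δ`.

In both regimes the tail is exponential in `n d`, and a union bound over `d ≥ d₀` finishes the
proof. Full rank of the first block makes the checks solvable slot by slot, which yields the
encoder. -/

theorem map_pi_comp_injective {ι κ Ω : Type*} [Fintype ι] [Fintype κ] [MeasurableSpace Ω]
    (ν : ι → Measure Ω) [∀ i, IsProbabilityMeasure (ν i)] {f : κ → ι}
    (hf : Function.Injective f) :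
    Measure.map (fun (z : ι → Ω) (l : κ) => z (f l)) (Measure.pi ν) =
      Measure.pi fun l => ν (f l) := by
  have h : iIndepFun (fun i (z : ι → Ω) => z i) (Measure.pi ν) :=
    iIndepFun_pi (X := fun _ ω => ω) fun _ => aemeasurable_id
  have h2 := (iIndepFun_iff_map_fun_eq_pi_map
    (fun l => (measurable_pi_apply (f l)).aemeasurable)).1 (h.precomp hf)
  rw [h2]
  congr 1
  funext l
  exact (measurePreserving_eval ν (f l)).map_eq

theorem lintegral_pi_prod {ι Ω : Type*} [Fintype ι] [MeasurableSpace Ω]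
    (ν : ι → Measure Ω) [∀ i, IsProbabilityMeasure (ν i)] {f : ι → Ω → ℝ≥0∞}
    (hf : ∀ i, Measurable (f i)) :
    ∫⁻ z, ∏ i, f i (z i) ∂Measure.pi ν = ∏ i, ∫⁻ x, f i x ∂ν i := by
  refine (lintegral_prod_eq_prod_lintegral_of_indepFun Finset.univ
    (fun i (z : ι → Ω) => f i (z i)) (iIndepFun_pi fun i => (hf i).aemeasurable)
    (fun i => (hf i).comp (measurable_pi_apply i))).trans ?_
  refine Finset.prod_congr rfl fun i _ => ?_
  exact (measurePreserving_eval ν i).lintegral_comp (hf i)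

/-- Jensen's inequality for the concave power, read off from the monotonicity of `L^p` norms on a
probability space. It brings the ensemble average inside Gallager's `ρ`-th power. -/
theorem lintegral_rpow_le_rpow_lintegral {Ω : Type*} [MeasurableSpace Ω] {P : Measure Ω}
    [IsProbabilityMeasure P] {f : Ω → ℝ≥0∞} (hf : Measurable f) {ρ : ℝ} (h0 : 0 ≤ ρ)
    (h1 : ρ ≤ 1) : ∫⁻ x, f x ^ ρ ∂P ≤ (∫⁻ x, f x ∂P) ^ ρ := by
  rcases h0.eq_or_lt with rfl | h0
  · simp
  have h := eLpNorm'_le_eLpNorm'_of_exponent_le h0 h1 P hf.aestronglyMeasurable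
  simp only [eLpNorm', enorm_eq_self, ENNReal.rpow_one, one_div, inv_one] at h
  have h2 := ENNReal.rpow_le_rpow h h0.le
  rwa [← ENNReal.rpow_mul, inv_mul_cancel₀ h0.ne', ENNReal.rpow_one] at h2

theorem sum_prod_ite_eq_zero {ι R : Type*} [Fintype ι] [DecidableEq ι] [CommSemiring R] (r : ι → R) :
    ∑ e : ι → ZMod 2, ∏ i, (if e i = 0 then 1 else r i) = ∏ i, (1 + r i) := by
  have h := (Finset.prod_univ_sum (fun _ : ι => (Finset.univ : Finset (ZMod 2)))
    fun i x => if x = 0 then 1 else r i).symm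
  rw [Fintype.piFinset_univ] at h
  rw [h]
  refine Finset.prod_congr rfl fun i _ => ?_
  have : (Finset.univ : Finset (ZMod 2)) = {0, 1} := by decide
  rw [this, Finset.sum_pair (by decide)]
  simp

/-! ## The channel -/

namespace MBIOSChannel

variable {Z : Type*} [MeasurableSpace Z] (W : MBIOSChannel Z)

theorem integrable_p (x : ZMod 2) : Integrable (W.p x) W.μ := by
  by_contra h
  have := W.integral_p x
  rw [integral_undef h] at this
  exact zero_ne_one this

instance isProbabilityMeasure_law (x : ZMod 2) : IsProbabilityMeasure (W.law x) := by
  refine ⟨?_⟩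
  rw [law, withDensity_apply _ MeasurableSet.univ, Measure.restrict_univ,
    ← ofReal_integral_eq_lintegral_ofReal (W.integrable_p x) (.of_forall (W.p_nonneg x)),
    W.integral_p, ENNReal.ofReal_one]

instance isProbabilityMeasure_outputLaw {ι : Type*} [Fintype ι] (x : ι → ZMod 2) :
    IsProbabilityMeasure (W.outputLaw x) := by
  unfold outputLaw; infer_instance

/-- Likelihood ratios divide by the density of the sent symbol; almost surely this is not a division
by zero. -/
theorem ae_pos_law (x : ZMod 2) : ∀ᵐ z ∂W.law x, 0 < W.p x z := by
  rw [law, ae_withDensity_iff (W.measurable_p x).ennreal_ofReal]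
  refine .of_forall fun z hz => ?_
  exact ENNReal.ofReal_pos.1 (pos_iff_ne_zero.2 hz)

theorem ae_pos_outputLaw {ι : Type*} [Fintype ι] (x : ι → ZMod 2) :
    ∀ᵐ z ∂W.outputLaw x, ∀ i, 0 < W.p (x i) (z i) := by
  rw [ae_all_iff]
  intro i
  exact (measurePreserving_eval (fun i => W.law (x i)) i).quasiMeasurePreserving.ae
    (W.ae_pos_law (x i))

/-- The bijection of the output alphabet that carries the law given `x` to the law given `0`. -/
def unflip (x : ZMod 2) (z : Z) : Z := if x = 0 then z else W.flip z

theorem measurable_unflip (x : ZMod 2) : Measurable (W.unflip x) := by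
  unfold unflip
  split_ifs
  · exact measurable_id
  · exact W.measurePreserving_flip.measurable

theorem p_add_unflip (x y : ZMod 2) (z : Z) : W.p (x + y) z = W.p y (W.unflip x z) := by
  have h1 : ∀ z, W.p 0 z = W.p 1 (W.flip z) := fun z => by rw [W.p_one, W.flip_flip]
  have h2 : ∀ x : ZMod 2, x = 0 ∨ x = 1 := by decide
  rcases h2 x with rfl | rfl
  · simp [unflip]
  · rcases h2 y with rfl | rfl
    · simp [unflip, W.p_one]
    · rw [show (1 + 1 : ZMod 2) = 0 by decide]
      simp [unflip, h1]

theorem map_unflip_law (x : ZMod 2) : (W.law x).map (W.unflip x) = W.law 0 := by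
  have hmp : MeasurePreserving (W.unflip x) W.μ W.μ := by
    unfold unflip
    split_ifs
    · exact MeasurePreserving.id _
    · exact W.measurePreserving_flip
  ext s hs
  rw [Measure.map_apply (W.measurable_unflip x) hs, law, law,
    withDensity_apply _ (W.measurable_unflip x hs), withDensity_apply _ hs,
    ← hmp.setLIntegral_comp_preimage hs (W.measurable_p 0).ennreal_ofReal]
  refine setLIntegral_congr_fun (W.measurable_unflip x hs) fun z _ => ?_
  have := W.p_add_unflip x 0 z
  rw [add_zero] at this
  simp only [this]

/-- The likelihood ratio of `1` against `0`. -/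
def ratio (z : Z) : ℝ≥0∞ := ENNReal.ofReal (W.p 1 z / W.p 0 z)

theorem measurable_ratio : Measurable W.ratio :=
  ((W.measurable_p 1).div (W.measurable_p 0)).ennreal_ofReal

/-- Gallager's upper bound on the probability that, when the zero word is sent, the likelihood of
some word of `S` is at least that of the zero word. -/
def gallagerBound (ρ : ℝ) {ι : Type*} [Fintype ι] [DecidableEq ι] (S : Set (ι → ZMod 2)) : ℝ≥0∞ :=
  ∫⁻ y, (∑ e, S.indicator (fun e => ∏ i, if e i = 0 then 1 else W.ratio (y i) ^ (1 / (1 + ρ))) e)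
    ^ ρ ∂W.outputLaw fun _ => 0

theorem lintegral_law_zero {f : Z → ℝ≥0∞} (hf : Measurable f) :
    ∫⁻ z, f z ∂W.law 0 = ∫⁻ z, ENNReal.ofReal (W.p 0 z) * f z ∂W.μ := by
  rw [law, lintegral_withDensity_eq_lintegral_mul _ (W.measurable_p 0).ennreal_ofReal hf]
  rfl

theorem integrable_sqrt : Integrable (fun z => Real.sqrt (W.p 0 z * W.p 1 z)) W.μ := by
  refine ((W.integrable_p 0).add (W.integrable_p 1)).mono'
    ((W.measurable_p 0).mul (W.measurable_p 1)).sqrt.aestronglyMeasurable (.of_forall fun z => ?_)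
  have h0 := W.p_nonneg 0 z
  have h1 := W.p_nonneg 1 z
  rw [Real.norm_of_nonneg (Real.sqrt_nonneg _), Real.sqrt_le_left (by simp; positivity)]
  simp only [Pi.add_apply]
  nlinarith

theorem zeta_nonneg : 0 ≤ W.zeta := integral_nonneg fun _ => Real.sqrt_nonneg _

theorem lintegral_ratio_rpow_half :
    ∫⁻ z, W.ratio z ^ (1 / (1 + 1) : ℝ) ∂W.law 0 = ENNReal.ofReal W.zeta := by
  rw [lintegral_law_zero _ (W.measurable_ratio.pow_const _), zeta,
    ofReal_integral_eq_lintegral_ofReal W.integrable_sqrt (.of_forall fun _ => Real.sqrt_nonneg _)]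
  refine lintegral_congr fun z => ?_
  have h0 := W.p_nonneg 0 z
  have h1 := W.p_nonneg 1 z
  rw [ratio, ENNReal.ofReal_rpow_of_nonneg (by positivity) (by norm_num),
    ← ENNReal.ofReal_mul h0]
  congr 1
  rw [show (1 / (1 + 1) : ℝ) = 1 / 2 by norm_num, ← Real.sqrt_eq_rpow, Real.sqrt_div h1,
    Real.sqrt_mul h0]
  rcases h0.eq_or_lt with h | h
  · simp [← h]
  · have : Real.sqrt (W.p 0 z) ≠ 0 := (Real.sqrt_pos.2 h).ne'
    field_simp
    rw [Real.sq_sqrt h0, mul_comm]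

/-- At `ρ = 1` the integrand is linear in the words, so independence of the outputs turns Gallager's
bound into the Bhattacharyya union bound. -/
theorem gallagerBound_one {ι : Type*} [Fintype ι] [DecidableEq ι] (S : Set (ι → ZMod 2)) :
    W.gallagerBound 1 S =
      ∑ e, S.indicator (fun e => ∏ i, if e i = 0 then 1 else ENNReal.ofReal W.zeta) e := by
  have hm : ∀ (e : ι → ZMod 2) (i : ι), Measurable
      (fun z : Z => if e i = 0 then (1 : ℝ≥0∞) else W.ratio z ^ (1 / (1 + 1) : ℝ)) := by
    intro e i
    split_ifs
    · exact measurable_const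
    · exact W.measurable_ratio.pow_const _
  simp only [gallagerBound, ENNReal.rpow_one]
  rw [lintegral_finsetSum]
  · refine Finset.sum_congr rfl fun e _ => ?_
    by_cases he : e ∈ S
    · simp only [he, Set.indicator_of_mem]
      rw [outputLaw, lintegral_pi_prod _ (hm e)]
      refine Finset.prod_congr rfl fun i _ => ?_
      split_ifs
      · simp
      · exact W.lintegral_ratio_rpow_half
    · simp [he]
  · intro e _
    by_cases he : e ∈ S
    · simp only [he, Set.indicator_of_mem]
      exact Finset.measurable_prod _ fun i _ => (hm e i).comp (measurable_pi_apply i)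
    · simp [he]

theorem gallagerBound_zero {ι : Type*} [Fintype ι] [DecidableEq ι] (S : Set (ι → ZMod 2)) :
    W.gallagerBound 0 S = 1 := by
  simp [gallagerBound]

/-- The integral in Gallager's bound factorizes when the sum extends over all words. -/
theorem lintegral_sum_prod_rpow {ι : Type*} [Fintype ι] [DecidableEq ι] (ρ : ℝ) (hρ : 0 ≤ ρ) :
    ∫⁻ y, (∑ e : ι → ZMod 2, ∏ i, if e i = 0 then 1 else W.ratio (y i) ^ (1 / (1 + ρ))) ^ ρ
      ∂W.outputLaw (fun _ : ι => 0) =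
      (∫⁻ z, (1 + W.ratio z ^ (1 / (1 + ρ))) ^ ρ ∂W.law 0) ^ Fintype.card ι := by
  have : ∀ y : ι → Z, (∑ e : ι → ZMod 2, ∏ i, if e i = 0 then 1 else
      W.ratio (y i) ^ (1 / (1 + ρ))) ^ ρ = ∏ i, (1 + W.ratio (y i) ^ (1 / (1 + ρ))) ^ ρ := by
    intro y
    rw [sum_prod_ite_eq_zero, ENNReal.prod_rpow_of_nonneg hρ]
  simp only [this]
  rw [outputLaw, lintegral_pi_prod (fun _ => W.law 0) (f := fun _ z =>
    (1 + W.ratio z ^ (1 / (1 + ρ))) ^ ρ)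
    (fun _ => (measurable_const.add (W.measurable_ratio.pow_const _)).pow_const _)]
  simp

/-! ## Gallager's function -/

/-- The integral in Gallager's function. -/
def gallagerIntegral (ρ : ℝ) (Q : ZMod 2 → ℝ) : ℝ :=
  ∫ z, (∑ x, Q x * W.p x z ^ (1 / (1 + ρ))) ^ (1 + ρ) ∂W.μ

theorem zmod_two_sum {M : Type*} [AddCommMonoid M] (f : ZMod 2 → M) : ∑ x, f x = f 0 + f 1 := by
  have : (Finset.univ : Finset (ZMod 2)) = {0, 1} := by decide
  rw [this, Finset.sum_pair (by decide)]

theorem rpow_rpow_gallager {ρ x : ℝ} (hρ : 0 ≤ ρ) (hx : 0 ≤ x) :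
    (x ^ (1 / (1 + ρ))) ^ (1 + ρ) = x := by
  rw [← Real.rpow_mul hx, one_div_mul_cancel (by positivity), Real.rpow_one]

theorem measurable_gallager (ρ : ℝ) (Q : ZMod 2 → ℝ) :
    Measurable fun z => (∑ x, Q x * W.p x z ^ (1 / (1 + ρ))) ^ (1 + ρ) := by
  have := W.measurable_p
  fun_prop

theorem gallager_nonneg {ρ : ℝ} {Q : ZMod 2 → ℝ} (hQ : Q ∈ stdSimplex ℝ (ZMod 2)) (z : Z) :
    0 ≤ (∑ x, Q x * W.p x z ^ (1 / (1 + ρ))) ^ (1 + ρ) :=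
  Real.rpow_nonneg (Finset.sum_nonneg fun x _ =>
    mul_nonneg (hQ.1 x) (Real.rpow_nonneg (W.p_nonneg x z) _)) _

theorem integrable_gallager {ρ : ℝ} (hρ : 0 ≤ ρ) {Q : ZMod 2 → ℝ}
    (hQ : Q ∈ stdSimplex ℝ (ZMod 2)) :
    Integrable (fun z => (∑ x, Q x * W.p x z ^ (1 / (1 + ρ))) ^ (1 + ρ)) W.μ := by
  refine (integrable_finsetSum Finset.univ fun x _ => (W.integrable_p x).const_mul (Q x)).mono'
    (W.measurable_gallager ρ Q).aestronglyMeasurable (.of_forall fun z => ?_)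
  rw [Real.norm_of_nonneg (W.gallager_nonneg hQ z)]
  refine (Real.rpow_arith_mean_le_arith_mean_rpow Finset.univ Q _ (fun x _ => hQ.1 x) hQ.2
    (fun x _ => Real.rpow_nonneg (W.p_nonneg x z) _) (by linarith)).trans (le_of_eq ?_)
  exact Finset.sum_congr rfl fun x _ => by rw [rpow_rpow_gallager hρ (W.p_nonneg x z)]

/-- The uniform distribution on the inputs. -/
def uniformInput : ZMod 2 → ℝ := fun _ => 1 / 2

theorem uniformInput_mem : uniformInput ∈ stdSimplex ℝ (ZMod 2) :=
  ⟨fun _ => by norm_num [uniformInput], by rw [zmod_two_sum]; norm_num [uniformInput]⟩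

theorem gallagerIntegral_uniform_pos {ρ : ℝ} (hρ : 0 ≤ ρ) :
    0 < W.gallagerIntegral ρ uniformInput := by
  have h : ∫ z, (1 / 2 : ℝ) ^ (1 + ρ) * W.p 0 z ∂W.μ ≤ W.gallagerIntegral ρ uniformInput := by
    refine integral_mono ((W.integrable_p 0).const_mul _)
      (W.integrable_gallager hρ uniformInput_mem) fun z => ?_
    have h0 := Real.rpow_nonneg (W.p_nonneg 0 z) (1 / (1 + ρ))
    have h1 := Real.rpow_nonneg (W.p_nonneg 1 z) (1 / (1 + ρ))
    change (1 / 2 : ℝ) ^ (1 + ρ) * W.p 0 z ≤ _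
    rw [zmod_two_sum]
    conv_lhs => rw [← rpow_rpow_gallager hρ (W.p_nonneg 0 z)]
    rw [← Real.mul_rpow (by norm_num) h0]
    refine Real.rpow_le_rpow (by positivity) ?_ (by linarith)
    simp only [uniformInput]
    linarith
  refine lt_of_lt_of_le ?_ h
  rw [integral_const_mul, W.integral_p]
  positivity

theorem integral_comp_flip (f : Z → ℝ) (hf : Measurable f) :
    ∫ z, f (W.flip z) ∂W.μ = ∫ z, f z ∂W.μ := by
  have h := integral_map W.measurePreserving_flip.measurable.aemeasurable (μ := W.μ) (f := f)
    hf.aestronglyMeasurable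
  rw [W.measurePreserving_flip.map_eq] at h
  exact h.symm

/-- Composing the integrand for `Q` with the flip exchanges the two masses of `Q` and keeps the
integral. By convexity of the power `1 + ρ`, averaging the two integrands dominates the integrand
for the averaged, hence uniform, input. -/
theorem gallagerIntegral_uniform_le {ρ : ℝ} (hρ : 0 ≤ ρ) {Q : ZMod 2 → ℝ}
    (hQ : Q ∈ stdSimplex ℝ (ZMod 2)) :
    W.gallagerIntegral ρ uniformInput ≤ W.gallagerIntegral ρ Q := by
  set F : Z → ℝ := fun z => (∑ x, Q x * W.p x z ^ (1 / (1 + ρ))) ^ (1 + ρ) with hF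
  have hi : Integrable F W.μ := W.integrable_gallager hρ hQ
  have hi' : Integrable (fun z => F (W.flip z)) W.μ :=
    W.measurePreserving_flip.integrable_comp_of_integrable hi
  have h : W.gallagerIntegral ρ uniformInput ≤ ∫ z, (1 / 2 * F z + 1 / 2 * F (W.flip z)) ∂W.μ := by
    refine integral_mono (W.integrable_gallager hρ uniformInput_mem)
      ((hi.const_mul _).add (hi'.const_mul _)) fun z => ?_
    have hm : ∀ z, ∑ x, Q x * W.p x z ^ (1 / (1 + ρ)) ∈ Set.Ici (0 : ℝ) := fun z =>
      Finset.sum_nonneg fun x _ => mul_nonneg (hQ.1 x) (Real.rpow_nonneg (W.p_nonneg x _) _)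
    have hc := (convexOn_rpow (show 1 ≤ 1 + ρ by linarith)).2 (hm z) (hm (W.flip z))
      (show (0 : ℝ) ≤ 1 / 2 by norm_num) (show (0 : ℝ) ≤ 1 / 2 by norm_num) (by norm_num)
    simp only [smul_eq_mul] at hc
    refine le_trans (le_of_eq ?_) hc
    have hs := hQ.2
    rw [zmod_two_sum] at hs
    have h0 : W.p 0 (W.flip z) = W.p 1 z := (W.p_one z).symm
    have h1 : W.p 1 (W.flip z) = W.p 0 z := by rw [W.p_one, W.flip_flip]
    simp only [zmod_two_sum, h0, h1, uniformInput]
    congr 1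
    linear_combination (-1 / 2 * (W.p 0 z ^ (1 / (1 + ρ)) + W.p 1 z ^ (1 / (1 + ρ)))) * hs
  refine h.trans (le_of_eq ?_)
  rw [integral_add (hi.const_mul _) (hi'.const_mul _), integral_const_mul, integral_const_mul,
    W.integral_comp_flip F (W.measurable_gallager ρ Q)]
  simp only [gallagerIntegral, ← hF]
  ring

/-- With `a = 1 / (1 + ρ)`, the integrand against `μ` is `p₀^a (p₀^a + p₁^a)^ρ`. Adding its flip
yields `(p₀^a + p₁^a)^(1 + ρ)`, a multiple of the integrand in Gallager's function, while the flip
preserves the integral. -/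
theorem lintegral_one_add_ratio_rpow {ρ : ℝ} (hρ : 0 ≤ ρ) :
    ∫⁻ z, (1 + W.ratio z ^ (1 / (1 + ρ))) ^ ρ ∂W.law 0 =
      ENNReal.ofReal (2 ^ ρ * W.gallagerIntegral ρ uniformInput) := by
  have ha : 0 ≤ 1 / (1 + ρ) := by positivity
  set F : Z → ℝ := fun z => W.p 0 z * (1 + (W.p 1 z / W.p 0 z) ^ (1 / (1 + ρ))) ^ ρ with hF
  set U : Z → ℝ := fun z => (∑ x, uniformInput x * W.p x z ^ (1 / (1 + ρ))) ^ (1 + ρ) with hU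
  have hFm : Measurable F := by
    have := W.measurable_p
    fun_prop
  have hF0 : ∀ z, 0 ≤ F z := fun z => by
    have h0 := W.p_nonneg 0 z
    have h1 := W.p_nonneg 1 z
    positivity
  have hFeq : ∀ z, F z = W.p 0 z ^ (1 / (1 + ρ)) *
      (W.p 0 z ^ (1 / (1 + ρ)) + W.p 1 z ^ (1 / (1 + ρ))) ^ ρ := by
    intro z
    have h0 := W.p_nonneg 0 z
    have h1 := W.p_nonneg 1 z
    rcases h0.eq_or_lt with h | h
    · simp only [hF, ← h, zero_mul]
      rw [Real.zero_rpow (by positivity), zero_mul]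
    · simp only [hF]
      have hp : 0 < W.p 0 z ^ (1 / (1 + ρ)) := Real.rpow_pos_of_pos h _
      have e1 : 1 + (W.p 1 z / W.p 0 z) ^ (1 / (1 + ρ)) =
          (W.p 0 z ^ (1 / (1 + ρ)) + W.p 1 z ^ (1 / (1 + ρ))) / W.p 0 z ^ (1 / (1 + ρ)) := by
        rw [Real.div_rpow h1 h0]
        field_simp
      rw [e1, Real.div_rpow (by positivity) (by positivity)]
      have e2 : W.p 0 z = W.p 0 z ^ (1 / (1 + ρ)) * (W.p 0 z ^ (1 / (1 + ρ))) ^ ρ := by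
        conv_lhs => rw [← rpow_rpow_gallager hρ h0]
        rw [Real.rpow_add hp, Real.rpow_one]
      have : 0 < (W.p 0 z ^ (1 / (1 + ρ))) ^ ρ := Real.rpow_pos_of_pos hp _
      conv_lhs => enter [1]; rw [e2]
      field_simp
  have hsum : ∀ z, F z + F (W.flip z) = 2 ^ (1 + ρ) * U z := by
    intro z
    have h0 : W.p 0 (W.flip z) = W.p 1 z := (W.p_one z).symm
    have h1 : W.p 1 (W.flip z) = W.p 0 z := by rw [W.p_one, W.flip_flip]
    have n0 := Real.rpow_nonneg (W.p_nonneg 0 z) (1 / (1 + ρ))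
    have n1 := Real.rpow_nonneg (W.p_nonneg 1 z) (1 / (1 + ρ))
    rw [hFeq, hFeq, h0, h1]
    simp only [hU, zmod_two_sum, uniformInput]
    rw [← mul_add, Real.mul_rpow (by norm_num) (by positivity), ← mul_assoc,
      ← Real.mul_rpow (by norm_num) (by norm_num), show (2 * (1 / 2) : ℝ) = 1 by norm_num,
      Real.one_rpow, one_mul, add_comm (W.p 1 z ^ (1 / (1 + ρ))), ← add_mul,
      Real.rpow_add' (by positivity) (by positivity), Real.rpow_one]
  have hUi : Integrable U W.μ := W.integrable_gallager hρ uniformInput_mem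
  have hFi : Integrable F W.μ := by
    refine (hUi.const_mul (2 ^ (1 + ρ))).mono' hFm.aestronglyMeasurable (.of_forall fun z => ?_)
    rw [Real.norm_of_nonneg (hF0 z), ← hsum]
    linarith [hF0 (W.flip z)]
  have hint : ∫ z, F z ∂W.μ = 2 ^ ρ * W.gallagerIntegral ρ uniformInput := by
    have h := integral_add hFi (W.measurePreserving_flip.integrable_comp_of_integrable hFi)
    simp only [Function.comp_def, hsum] at h
    rw [W.integral_comp_flip F hFm, integral_const_mul, Real.rpow_add (by norm_num),
      Real.rpow_one] at h
    change 2 * 2 ^ ρ * W.gallagerIntegral ρ uniformInput = _ at h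
    linarith
  have hm : Measurable fun z => (1 + W.ratio z ^ (1 / (1 + ρ))) ^ ρ :=
    (measurable_const.add (W.measurable_ratio.pow_const _)).pow_const _
  rw [lintegral_law_zero _ hm, ← hint, ofReal_integral_eq_lintegral_ofReal hFi (.of_forall hF0)]
  refine lintegral_congr fun z => ?_
  have h0 := W.p_nonneg 0 z
  have h1 := W.p_nonneg 1 z
  rw [ratio, ENNReal.ofReal_rpow_of_nonneg (by positivity) ha, ← ENNReal.ofReal_one,
    ← ENNReal.ofReal_add (by norm_num) (by positivity),
    ENNReal.ofReal_rpow_of_nonneg (by positivity) hρ, ← ENNReal.ofReal_mul h0]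

end MBIOSChannel

/-! ## Words as sequences of blocks -/

section Blocks

variable {m n k : ℕ}

/-- The blocks of a word, followed by zeros. -/
def block {t : ℕ} (c : Fin t × Fin n → ZMod 2) (s : ℕ) : Fin n → ZMod 2 :=
  fun j => if h : s < t then c (⟨s, h⟩, j) else 0

/-- A message sequence, followed by zeros. -/
def extend {t : ℕ} (b : Fin t → Fin k → ZMod 2) (s : ℕ) : Fin k → ZMod 2 :=
  if h : s < t then b ⟨s, h⟩ else 0

theorem block_coe {t : ℕ} (c : Fin t × Fin n → ZMod 2) (s : Fin t) (j : Fin n) :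
    block c s j = c (s, j) := by
  simp [block]

theorem extend_coe {t : ℕ} (b : Fin t → Fin k → ZMod 2) (s : Fin t) :
    extend b s = b s := by
  simp [extend]

theorem eq_of_block_eq {t : ℕ} {c c' : Fin t × Fin n → ZMod 2}
    (h : ∀ s < t, block c s = block c' s) : c = c' := by
  ext ⟨s, j⟩
  rw [← block_coe c, ← block_coe c', h s s.2]

theorem sum_fin_ite_le {M : Type*} [AddCommMonoid M] {t : ℕ} (r : Fin t) (f : ℕ → M) :
    ∑ s : Fin t, (if s ≤ r then f s else 0) = ∑ s ∈ Finset.range (r + 1), f s := by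
  have h := Fin.sum_univ_eq_sum_range (fun s => if s ≤ (r : ℕ) then f s else 0) t
  simp only [Fin.val_fin_le] at h
  rw [h, ← Finset.sum_filter]
  refine Finset.sum_congr ?_ fun _ _ => rfl
  ext s
  simp only [Finset.mem_filter, Finset.mem_range]
  have := r.2
  omega

theorem mem_code_iff (H : ℕ → Fin m → Fin n → ZMod 2) {t : ℕ} (c : Fin t × Fin n → ZMod 2) :
    c ∈ code H t ↔
      ∀ r < t, ∑ s ∈ Finset.range (r + 1), (Matrix.of (H (r - s))).mulVec (block c s) = 0 := by
  have key : ∀ (r : Fin t) (i : Fin m), (toeplitz H t).mulVec c (r, i) =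
      (∑ s ∈ Finset.range ((r : ℕ) + 1), (Matrix.of (H (r - s))).mulVec (block c s)) i := by
    intro r i
    rw [Finset.sum_apply,
      ← sum_fin_ite_le r fun s => (Matrix.of (H (r - s))).mulVec (block c s) i]
    simp only [Matrix.mulVec, dotProduct, toeplitz, Matrix.of_apply, Fintype.sum_prod_type,
      block_coe]
    refine Finset.sum_congr rfl fun s _ => ?_
    split_ifs <;> simp
  constructor
  · intro h r hr
    ext i
    rw [← key ⟨r, hr⟩ i]
    exact congrFun h _
  · intro h
    change (toeplitz H t).mulVec c = 0
    ext ⟨r, i⟩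
    rw [key, h r r.2]
    rfl

theorem block_encode (G : ℕ → ℕ → Matrix (Fin n) (Fin k) (ZMod 2)) {t : ℕ}
    (b : Fin t → Fin k → ZMod 2) {r : ℕ} (hr : r < t) :
    block (encode G t b) r = ∑ j ∈ Finset.range (r + 1), (G r j).mulVec (extend b j) := by
  ext l
  rw [Finset.sum_apply]
  have h := sum_fin_ite_le (⟨r, hr⟩ : Fin t) fun j => (G r j).mulVec (extend b j) l
  simp only at h
  rw [← h]
  simp [block, hr, encode, extend_coe]

end Blocks

/-! ## Existence of causal encoders -/

section Encoder

variable {m n k : ℕ}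

/-- The generator blocks obtained by solving the parity checks one time slot after the other: the
columns of `K` span the kernel of the first parity check block and `P` is its right inverse. -/
def generator (H : ℕ → Fin m → Fin n → ZMod 2) (K : Matrix (Fin n) (Fin k) (ZMod 2))
    (P : Matrix (Fin n) (Fin m) (ZMod 2)) : ℕ → Matrix (Fin n) (Fin k) (ZMod 2)
  | 0 => K
  | l + 1 => -(P * ∑ s : Fin (l + 1), Matrix.of (H (l + 1 - s)) * generator H K P s)
termination_by l => l
decreasing_by exact s.2

theorem sum_parity_generator {H : ℕ → Fin m → Fin n → ZMod 2}
    {K : Matrix (Fin n) (Fin k) (ZMod 2)} {P : Matrix (Fin n) (Fin m) (ZMod 2)}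
    (hK : Matrix.of (H 0) * K = 0) (hP : Matrix.of (H 0) * P = 1) (M : ℕ) :
    ∑ l ∈ Finset.range (M + 1), Matrix.of (H (M - l)) * generator H K P l = 0 := by
  cases M with
  | zero => simp [generator, hK]
  | succ M =>
    rw [Finset.sum_range_succ, Nat.sub_self]
    conv_lhs => enter [2]; rw [generator]
    rw [Matrix.mul_neg, ← Matrix.mul_assoc, hP, Matrix.one_mul,
      Fin.sum_univ_eq_sum_range (fun s => Matrix.of (H (M + 1 - s)) * generator H K P s) (M + 1),
      add_neg_cancel]

theorem parity_generator {H : ℕ → Fin m → Fin n → ZMod 2}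
    {K : Matrix (Fin n) (Fin k) (ZMod 2)} {P : Matrix (Fin n) (Fin m) (ZMod 2)}
    (hK : Matrix.of (H 0) * K = 0) (hP : Matrix.of (H 0) * P = 1) (b : ℕ → Fin k → ZMod 2) (r : ℕ) :
    ∑ s ∈ Finset.range (r + 1), (Matrix.of (H (r - s))).mulVec
      (∑ j ∈ Finset.range (s + 1), (generator H K P (s - j)).mulVec (b j)) = 0 := by
  simp only [Matrix.mulVec_sum, Matrix.mulVec_mulVec]
  rw [Finset.sum_comm' (s' := fun j => Finset.Ico j (r + 1)) (t' := Finset.range (r + 1))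
    (by intro x y; simp only [Finset.mem_range, Finset.mem_Ico]; omega)]
  refine Finset.sum_eq_zero fun j hj => ?_
  have hj : j ≤ r := Nat.lt_succ_iff.1 (Finset.mem_range.1 hj)
  have h := sum_parity_generator hK hP (r - j)
  rw [← Matrix.sum_mulVec, Finset.sum_Ico_eq_sum_range, show r + 1 - j = r - j + 1 by omega]
  have e : ∑ l ∈ Finset.range (r - j + 1), Matrix.of (H (r - (j + l))) *
      generator H K P (j + l - j) = 0 := by
    rw [← h]
    refine Finset.sum_congr rfl fun l _ => ?_
    rw [Nat.sub_sub, Nat.add_sub_cancel_left]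
  rw [e, Matrix.zero_mulVec]

theorem exists_kernel_basis_and_right_inverse (A : Matrix (Fin m) (Fin n) (ZMod 2))
    (hA : A.rank = m) (hkm : k + m = n) :
    ∃ (K : Matrix (Fin n) (Fin k) (ZMod 2)) (P : Matrix (Fin n) (Fin m) (ZMod 2)),
      A * K = 0 ∧ A * P = 1 ∧ (∀ v, K.mulVec v = 0 → v = 0) ∧
        ∀ x, A.mulVec x = 0 → ∃ v, K.mulVec v = x := by
  have hr : Module.finrank (ZMod 2) (LinearMap.range A.mulVecLin) = m := hA
  have hsurj : LinearMap.range A.mulVecLin = ⊤ :=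
    Submodule.eq_top_of_finrank_eq (by rw [hr]; simp)
  obtain ⟨P, hP⟩ := LinearMap.exists_rightInverse_of_surjective A.mulVecLin hsurj
  have hk : Module.finrank (ZMod 2) (LinearMap.ker A.mulVecLin) = k := by
    have := LinearMap.finrank_range_add_finrank_ker A.mulVecLin
    rw [hr] at this
    simp at this
    omega
  let e : (Fin k → ZMod 2) ≃ₗ[ZMod 2] LinearMap.ker A.mulVecLin :=
    LinearEquiv.ofFinrankEq _ _ (by rw [hk]; simp)
  let Kl : (Fin k → ZMod 2) →ₗ[ZMod 2] (Fin n → ZMod 2) := (Submodule.subtype _).comp e.toLinearMap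
  have hKl : ∀ v, (LinearMap.toMatrix' Kl).mulVec v = (e v : Fin n → ZMod 2) := fun v => by
    rw [LinearMap.toMatrix'_mulVec]; rfl
  refine ⟨LinearMap.toMatrix' Kl, LinearMap.toMatrix' P, ?_, ?_, ?_, ?_⟩
  · refine Matrix.ext_of_mulVec_single fun i => ?_
    rw [← Matrix.mulVec_mulVec, hKl, Matrix.zero_mulVec]
    exact (e _).2
  · refine Matrix.ext_of_mulVec_single fun i => ?_
    rw [← Matrix.mulVec_mulVec, LinearMap.toMatrix'_mulVec, Matrix.one_mulVec]
    exact LinearMap.congr_fun hP _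
  · intro v hv
    rw [hKl] at hv
    exact e.map_eq_zero_iff.1 (Subtype.ext hv)
  · intro x hx
    refine ⟨e.symm ⟨x, hx⟩, ?_⟩
    rw [hKl, e.apply_symm_apply]

/-- Given the earlier blocks, the check of a slot determines the current block up to the kernel of
`H 0`, and full rank makes it solvable. The `k` dimensions of that kernel carry the message of the
slot. -/
theorem exists_isEncoder {H : ℕ → Fin m → Fin n → ZMod 2} (hH : (Matrix.of (H 0)).rank = m)
    (hkm : k + m = n) : ∃ G : ℕ → ℕ → Matrix (Fin n) (Fin k) (ZMod 2), IsEncoder H G := by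
  obtain ⟨K, P, hK, hP, hinj, hsurj⟩ := exists_kernel_basis_and_right_inverse _ hH hkm
  refine ⟨fun i j => generator H K P (i - j), fun t => ⟨?_, ?_, ?_⟩⟩
  · intro b _
    rw [mem_code_iff]
    intro r hr
    rw [← parity_generator hK hP (extend b) r]
    refine Finset.sum_congr rfl fun s hs => ?_
    rw [block_encode _ _ (by have := Finset.mem_range.1 hs; omega)]
  · intro b _ b' _ hbb
    have key : ∀ r < t, extend b r = extend b' r := by
      intro r
      induction r using Nat.strong_induction_on with
      | _ r ih =>
        intro hr
        have h := congrArg (fun c => block c r) hbb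
        simp only [block_encode _ _ hr] at h
        rw [Finset.sum_range_succ, Finset.sum_range_succ, Nat.sub_self, generator,
          Finset.sum_congr rfl fun j hj => by
            rw [ih j (Finset.mem_range.1 hj) (by have := Finset.mem_range.1 hj; omega)]] at h
        have h2 := add_left_cancel h
        have h3 := hinj (extend b r - extend b' r) (by rw [Matrix.mulVec_sub, h2, sub_self])
        exact sub_eq_zero.1 h3
    funext s
    rw [← extend_coe b, ← extend_coe b', key s s.2]
  · intro c hc
    rw [mem_code_iff] at hc
    -- Messages are recovered slot by slot: once the earlier blocks agree, the checks of slot `T`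
    -- for `c` and for the encoded word force their blocks to differ by an element of the kernel of
    -- `H 0`. Changing the message of slot `T` by `v` supplies it.
    have key : ∀ T ≤ t, ∃ b : ℕ → Fin k → ZMod 2, ∀ r < T,
        block c r = ∑ j ∈ Finset.range (r + 1), (generator H K P (r - j)).mulVec (b j) := by
      intro T
      induction T with
      | zero => exact fun _ => ⟨fun _ => 0, fun r hr => absurd hr (Nat.not_lt_zero r)⟩
      | succ T ih =>
        intro hT
        obtain ⟨b, hb⟩ := ih (by omega)
        have h1 := hc T hT
        have h2 := parity_generator hK hP b T
        rw [← h2, Finset.sum_range_succ, Finset.sum_range_succ,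
          Finset.sum_congr rfl fun s hs => by rw [hb s (Finset.mem_range.1 hs)]] at h1
        have h3 := add_left_cancel h1
        rw [Nat.sub_self, ← sub_eq_zero, ← Matrix.mulVec_sub] at h3
        obtain ⟨v, hv⟩ := hsurj _ h3
        refine ⟨Function.update b T (b T + v), fun r hr => ?_⟩
        have e : ∀ r ≤ T, ∑ j ∈ Finset.range r, (generator H K P (r - j)).mulVec
            (Function.update b T (b T + v) j) =
            ∑ j ∈ Finset.range r, (generator H K P (r - j)).mulVec (b j) := by
          intro r hr
          refine Finset.sum_congr rfl fun j hj => ?_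
          have := Finset.mem_range.1 hj
          rw [Function.update_of_ne (by omega)]
        rw [Finset.sum_range_succ, e r (by omega)]
        rcases (Nat.lt_succ_iff.1 hr).eq_or_lt with rfl | hr
        · rw [Function.update_self, Nat.sub_self, Matrix.mulVec_add, generator, hv,
            Finset.sum_range_succ, Nat.sub_self, generator]
          abel
        · rw [Function.update_of_ne hr.ne, hb r hr, Finset.sum_range_succ]
    obtain ⟨b, hb⟩ := key t le_rfl
    refine ⟨fun s => b s, trivial, eq_of_block_eq fun r hr => ?_⟩
    rw [block_encode _ _ hr, hb r hr]
    refine Finset.sum_congr rfl fun j hj => ?_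
    have := Finset.mem_range.1 hj
    rw [extend, dif_pos (by omega)]

end Encoder

/-! ## The error probability of maximum likelihood decoding -/

section ErrorBound

variable {m n k : ℕ}

/-- The words of the code whose first block is nonzero. -/
def startingCode (H : ℕ → Fin m → Fin n → ZMod 2) (d : ℕ) : Set (Fin d × Fin n → ZMod 2) :=
  {e | e ∈ code H d ∧ block e 0 ≠ 0}

/-- The difference vanishes before slot `i`, and the Toeplitz blocks depend on time differences
only, so its checks from slot `i` on are those of the shifted word from slot `0` on. -/
theorem sub_mem_startingCode {H : ℕ → Fin m → Fin n → ZMod 2} {i d : ℕ}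
    {c c' : Fin (i + d) × Fin n → ZMod 2} (hc : c ∈ code H (i + d)) (hc' : c' ∈ code H (i + d))
    (heq : ∀ s < i, block c' s = block c s) (hne : block c' i ≠ block c i) :
    (fun q : Fin d × Fin n => c' (Fin.natAdd i q.1, q.2) - c (Fin.natAdd i q.1, q.2)) ∈
      startingCode H d := by
  set e := fun q : Fin d × Fin n => c' (Fin.natAdd i q.1, q.2) - c (Fin.natAdd i q.1, q.2) with he
  have hb : ∀ s, block e s = block c' (i + s) - block c (i + s) := by
    intro s
    ext j
    by_cases hs : s < d
    · simp [block, hs, he, Fin.natAdd]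
    · simp [block, hs]
  refine ⟨?_, ?_⟩
  · rw [mem_code_iff] at hc hc' ⊢
    intro r hr
    have h1 := hc (i + r) (by omega)
    have h2 := hc' (i + r) (by omega)
    rw [add_assoc, Finset.sum_range_add] at h1 h2
    rw [Finset.sum_congr rfl fun s hs => by rw [heq s (Finset.mem_range.1 hs)]] at h2
    have h3 := h2.trans h1.symm
    have h4 := sub_eq_zero.2 (add_left_cancel h3)
    rw [← Finset.sum_sub_distrib] at h4
    rw [← h4]
    refine Finset.sum_congr rfl fun s _ => ?_
    rw [hb, Matrix.mulVec_sub, Nat.add_sub_add_left]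
  · rw [hb, add_zero]
    exact sub_ne_zero.2 hne

/-- Otherwise two distinct message sequences of length `i + 1` would have the same codeword, against
injectivity of the encoder at time `i + 1`, not merely at time `t`. -/
theorem IsEncoder.block_ne {H : ℕ → Fin m → Fin n → ZMod 2}
    {G : ℕ → ℕ → Matrix (Fin n) (Fin k) (ZMod 2)} (hG : IsEncoder H G) {t : ℕ} {i : Fin t}
    {b b' : Fin t → Fin k → ZMod 2} (hne : b' i ≠ b i) (heq : ∀ j < i, b' j = b j) :
    block (encode G t b') i ≠ block (encode G t b) i := by
  intro h
  have hex : ∀ (b : Fin t → Fin k → ZMod 2), ∀ s < (i : ℕ) + 1,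
      extend (fun j : Fin (i + 1) => b ⟨j, by omega⟩) s = extend b s := by
    intro b s hs
    rw [extend, extend, dif_pos hs, dif_pos (by omega)]
  have henc : ∀ (b : Fin t → Fin k → ZMod 2), ∀ s < (i : ℕ) + 1,
      block (encode G (i + 1) (fun j : Fin (i + 1) => b ⟨j, by omega⟩)) s =
        block (encode G t b) s := by
    intro b s hs
    rw [block_encode _ _ hs, block_encode _ _ (by omega)]
    refine Finset.sum_congr rfl fun j hj => ?_
    rw [hex b j (by have := Finset.mem_range.1 hj; omega)]
  have h2 : encode G (i + 1) (fun j : Fin (i + 1) => b' ⟨j, by omega⟩) =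
      encode G (i + 1) (fun j : Fin (i + 1) => b ⟨j, by omega⟩) := by
    refine eq_of_block_eq fun s hs => ?_
    rw [henc _ s hs, henc _ s hs]
    rcases (Nat.lt_succ_iff.1 hs).eq_or_lt with rfl | hs'
    · exact h
    · rw [block_encode _ _ (by omega), block_encode _ _ (by omega)]
      refine Finset.sum_congr rfl fun j hj => ?_
      have hj : j ≤ s := Nat.lt_succ_iff.1 (Finset.mem_range.1 hj)
      have := heq ⟨j, by omega⟩ (by rw [Fin.lt_def]; simp only; omega)
      simp only [extend, dif_pos (show j < t by omega), this]
  have h3 := (hG (i + 1)).injOn trivial trivial h2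
  exact hne (congrFun h3 ⟨i, by omega⟩)

theorem EarliestErrorAt.sub_mem_startingCode {H : ℕ → Fin m → Fin n → ZMod 2}
    {G : ℕ → ℕ → Matrix (Fin n) (Fin k) (ZMod 2)} (hG : IsEncoder H G) {i d : ℕ}
    {b b' : Fin (i + d) → Fin k → ZMod 2} (h : EarliestErrorAt d b b') :
    (∀ s < i, block (encode G _ b') s = block (encode G _ b) s) ∧
    (fun q : Fin d × Fin n => encode G _ b' (Fin.natAdd i q.1, q.2) -
      encode G _ b (Fin.natAdd i q.1, q.2)) ∈ startingCode H d := by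
  obtain ⟨i', hi, hne, heq⟩ := h
  have hi' : (i' : ℕ) = i := by omega
  have h1 : ∀ s < i, block (encode G _ b') s = block (encode G _ b) s := by
    intro s hs
    rw [block_encode _ _ (by omega), block_encode _ _ (by omega)]
    refine Finset.sum_congr rfl fun j hj => ?_
    have hj : j ≤ s := Nat.lt_succ_iff.1 (Finset.mem_range.1 hj)
    have := heq ⟨j, by omega⟩ (by rw [Fin.lt_def]; simp only; omega)
    simp only [extend, dif_pos (show j < i + d by omega), this]
  refine ⟨h1, AnytimeCodes.sub_mem_startingCode ((hG _).mapsTo trivial) ((hG _).mapsTo trivial)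
    h1 ?_⟩
  have := hG.block_ne hne heq
  rwa [hi'] at this

variable {Z : Type*} [MeasurableSpace Z] (W : MBIOSChannel Z)

/-- The outputs in the last `d` blocks, transformed so that the zero word takes the place of
`c`. -/
def lastOutputs {i d : ℕ} (c : Fin (i + d) × Fin n → ZMod 2) (z : Fin (i + d) × Fin n → Z)
    (q : Fin d × Fin n) : Z :=
  W.unflip (c (Fin.natAdd i q.1, q.2)) (z (Fin.natAdd i q.1, q.2))

theorem measurePreserving_lastOutputs {i d : ℕ} (c : Fin (i + d) × Fin n → ZMod 2) :
    MeasurePreserving (lastOutputs W c) (W.outputLaw c) (W.outputLaw fun _ => 0) := by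
  have hinj : Function.Injective
      (fun q : Fin d × Fin n => ((Fin.natAdd i q.1, q.2) : Fin (i + d) × Fin n)) := by
    rintro ⟨a, b⟩ ⟨a', b'⟩ h
    simpa using h
  have h1 := map_pi_comp_injective (fun q => W.law (c q)) hinj
  have h2 := Measure.pi_map_pi (μ := fun q : Fin d × Fin n => W.law (c (Fin.natAdd i q.1, q.2)))
    (f := fun q => W.unflip (c (Fin.natAdd i q.1, q.2)))
    (hμ := fun q => by rw [W.map_unflip_law]; infer_instance)
    fun q => (W.measurable_unflip _).aemeasurable
  have hm1 : Measurable fun (z : Fin (i + d) × Fin n → Z) (q : Fin d × Fin n) =>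
      z (Fin.natAdd i q.1, q.2) := measurable_pi_lambda _ fun q => measurable_pi_apply _
  have hm2 : Measurable fun (z : Fin d × Fin n → Z) (q : Fin d × Fin n) =>
      W.unflip (c (Fin.natAdd i q.1, q.2)) (z q) :=
    measurable_pi_lambda _ fun q => (W.measurable_unflip _).comp (measurable_pi_apply _)
  refine ⟨hm2.comp hm1, ?_⟩
  simp only [W.map_unflip_law] at h2
  rw [MBIOSChannel.outputLaw, MBIOSChannel.outputLaw, ← h2, ← h1, Measure.map_map hm2 hm1]
  rfl

/-- Factors of the likelihood ratio cancel wherever the words agree, in particular before slot `i`.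
Where they differ, unflipping the output by the sent symbol turns the factor into the ratio of `1`
against `0`. -/
theorem one_le_prod_ratio {i d : ℕ} {c c' : Fin (i + d) × Fin n → ZMod 2}
    (heq : ∀ s < i, block c' s = block c s) {z : Fin (i + d) × Fin n → Z}
    (hpos : ∀ q, 0 < W.p (c q) (z q)) (hle : W.likelihood z c ≤ W.likelihood z c') :
    1 ≤ ∏ q : Fin d × Fin n, (if c' (Fin.natAdd i q.1, q.2) - c (Fin.natAdd i q.1, q.2) = 0
      then 1 else W.ratio (lastOutputs W c z q)) := by
  have h1 : 1 ≤ ∏ q, W.p (c' q) (z q) / W.p (c q) (z q) := by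
    rw [Finset.prod_div_distrib, one_le_div (Finset.prod_pos fun q _ => hpos q)]
    exact hle
  have h2 : ∏ q, W.p (c' q) (z q) / W.p (c q) (z q) =
      ∏ q : Fin d × Fin n, W.p (c' (Fin.natAdd i q.1, q.2)) (z (Fin.natAdd i q.1, q.2)) /
        W.p (c (Fin.natAdd i q.1, q.2)) (z (Fin.natAdd i q.1, q.2)) := by
    rw [Fintype.prod_prod_type, Fin.prod_univ_add, Fintype.prod_prod_type]
    rw [Finset.prod_eq_one, one_mul]
    intro s _
    refine Finset.prod_eq_one fun j _ => ?_
    have h := congrFun (heq s s.2) j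
    have hs := block_coe c (Fin.castAdd d s) j
    have hs' := block_coe c' (Fin.castAdd d s) j
    rw [Fin.val_castAdd] at hs hs'
    rw [← hs', h, hs]
    exact div_self (hpos _).ne'
  rw [h2] at h1
  have h3 := ENNReal.ofReal_le_ofReal h1
  rw [ENNReal.ofReal_one, ENNReal.ofReal_prod_of_nonneg
    fun q _ => div_nonneg (W.p_nonneg _ _) (W.p_nonneg _ _)] at h3
  refine h3.trans (Finset.prod_le_prod' fun q _ => le_of_eq ?_)
  split_ifs with h
  · rw [sub_eq_zero.1 h, div_self (hpos _).ne', ENNReal.ofReal_one]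
  · have h01 : ∀ x y : ZMod 2, x - y ≠ 0 → x = y + 1 := by decide
    rw [h01 _ _ h, MBIOSChannel.ratio, lastOutputs, W.p_add_unflip]
    congr 2
    rw [← W.p_add_unflip, add_zero]

/-- On the error event one summand, the one of the actual difference word, is at least `1`; so is
the sum, and so is its `ρ`-th power. Markov's inequality concludes. Ties count as errors, so the
tie-breaking rule is irrelevant. -/
theorem errorProb_le_gallagerBound {H : ℕ → Fin m → Fin n → ZMod 2}
    {G : ℕ → ℕ → Matrix (Fin n) (Fin k) (ZMod 2)} (hG : IsEncoder H G) {t : ℕ}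
    {dec : (Fin t × Fin n → Z) → (Fin t → Fin k → ZMod 2)}
    (hdec : IsMLDecoder W (encode G t) dec) {ρ : ℝ} (hρ : 0 ≤ ρ) (d : ℕ)
    (b : Fin t → Fin k → ZMod 2) :
    ENNReal.ofReal (errorProb W (encode G t) dec d b) ≤
      W.gallagerBound ρ (startingCode H d) := by
  rw [errorProb, ofReal_measureReal]
  by_cases hdt : d ≤ t
  swap
  · have : {z | EarliestErrorAt d b (dec z)} = ∅ := by
      ext z
      simp only [Set.mem_ofPred_eq, Set.mem_empty_iff_false, iff_false]
      rintro ⟨i, hi, -⟩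
      omega
    rw [this, measure_empty]
    exact zero_le
  obtain ⟨i, rfl⟩ := Nat.exists_eq_add_of_le' hdt
  set c := encode G (i + d) b with hc
  set F : (Fin d × Fin n → Z) → ℝ≥0∞ := fun y => (∑ e, (startingCode H d).indicator
    (fun e => ∏ q, if e q = 0 then 1 else W.ratio (y q) ^ (1 / (1 + ρ))) e) ^ ρ with hF
  have hFm : Measurable F := by
    refine Measurable.pow_const (Finset.measurable_sum _ fun e _ => ?_) _
    by_cases he : e ∈ startingCode H d
    · simp only [he, Set.indicator_of_mem]
      refine Finset.measurable_prod _ fun q _ => ?_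
      split_ifs
      · exact measurable_const
      · exact (W.measurable_ratio.comp (measurable_pi_apply q)).pow_const _
    · simp only [he, not_false_eq_true, Set.indicator_of_notMem]
      exact measurable_const
  have hmp := measurePreserving_lastOutputs W c
  calc W.outputLaw c {z | EarliestErrorAt d b (dec z)}
      ≤ W.outputLaw c {z | 1 ≤ F (lastOutputs W c z)} := by
        refine measure_mono_ae ?_
        filter_upwards [W.ae_pos_outputLaw c] with z hz hE
        obtain ⟨heq, hmem⟩ := EarliestErrorAt.sub_mem_startingCode hG hE
        have h1 := one_le_prod_ratio W heq hz (hdec.2 z b)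
        change 1 ≤ F (lastOutputs W c z)
        have h2 : (1 : ℝ≥0∞) ≤ ∑ e, (startingCode H d).indicator (fun e => ∏ q, if e q = 0 then 1
            else W.ratio (lastOutputs W c z q) ^ (1 / (1 + ρ))) e := by
          refine le_trans ?_ (Finset.single_le_sum (fun _ _ => zero_le) (Finset.mem_univ
            (fun q : Fin d × Fin n => encode G _ (dec z) (Fin.natAdd i q.1, q.2) -
              encode G _ b (Fin.natAdd i q.1, q.2))))
          rw [Set.indicator_of_mem hmem]
          have h3 := ENNReal.rpow_le_rpow h1 (show 0 ≤ 1 / (1 + ρ) by positivity)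
          rw [ENNReal.one_rpow, ← ENNReal.prod_rpow_of_nonneg (by positivity)] at h3
          refine h3.trans (Finset.prod_le_prod' fun q _ => le_of_eq ?_)
          split_ifs
          · rw [ENNReal.one_rpow]
          · rfl
        have h4 := ENNReal.rpow_le_rpow h2 hρ
        rwa [ENNReal.one_rpow] at h4
    _ ≤ ∫⁻ z, F (lastOutputs W c z) ∂W.outputLaw c := by
        have := mul_meas_ge_le_lintegral (μ := W.outputLaw c) (hFm.comp hmp.measurable) 1
        rwa [one_mul] at this
    _ = W.gallagerBound ρ (startingCode H d) := hmp.lintegral_comp hFm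

end ErrorBound

/-! ## The random ensemble -/

section Ensemble

variable {m n : ℕ}

/-- The parameter of the uniform distribution on `GF(2)`. -/
def half : unitInterval := ⟨1 / 2, by norm_num, by norm_num⟩

/-- The law of the block of index `τ` in the ensemble of half density. -/
def blockLaw (H1 : Fin m → Fin n → ZMod 2) (τ : ℕ) : Measure (Fin m → Fin n → ZMod 2) :=
  if τ = 0 then Measure.dirac H1
  else Measure.pi fun _ => Measure.pi fun _ =>
    bernoulliMeasure 1 0 half

instance isProbabilityMeasure_blockLaw (H1 : Fin m → Fin n → ZMod 2) (τ : ℕ) :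
    IsProbabilityMeasure (blockLaw H1 τ) := by
  unfold blockLaw
  split_ifs <;> infer_instance

theorem TZ_half_eq (H1 : Fin m → Fin n → ZMod 2) :
    TZ half H1 = Measure.infinitePi (blockLaw H1) := rfl

instance isProbabilityMeasure_TZ (p : unitInterval) (H1 : Fin m → Fin n → ZMod 2) :
    IsProbabilityMeasure (TZ p H1) := by
  have : ∀ τ : ℕ, IsProbabilityMeasure (if τ = 0 then Measure.dirac H1
    else Measure.pi fun _ => Measure.pi fun _ => bernoulliMeasure 1 0 p) := fun τ => by
      split_ifs <;> infer_instance
  unfold TZ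
  infer_instance

theorem ae_TZ_zero_eq (p : unitInterval) (H1 : Fin m → Fin n → ZMod 2) :
    ∀ᵐ H ∂TZ p H1, H 0 = H1 := by
  have : ∀ τ : ℕ, IsProbabilityMeasure (if τ = 0 then Measure.dirac H1
    else Measure.pi fun _ => Measure.pi fun _ => bernoulliMeasure 1 0 p) := fun τ => by
      split_ifs <;> infer_instance
  have h := measurePreserving_eval_infinitePi (fun τ : ℕ => if τ = 0 then Measure.dirac H1
    else Measure.pi fun _ => Measure.pi fun _ => bernoulliMeasure 1 0 p) 0
  refine h.quasiMeasurePreserving.ae (p := fun x => x = H1) ?_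
  simp

theorem map_add_bernoulli_half (u : ZMod 2) :
    (bernoulliMeasure (1 : ZMod 2) 0 half).map (fun x => u + x) =
      bernoulliMeasure 1 0 half := by
  have h2 : ∀ x : ZMod 2, x = 0 ∨ x = 1 := by decide
  have hm : Measurable fun x : ZMod 2 => u + x := Measurable.of_discrete
  have hs : unitInterval.toNNReal (unitInterval.symm half) =
      unitInterval.toNNReal half := by
    congr 1
    ext
    simp only [half, unitInterval.coe_symm_eq]
    norm_num
  rw [bernoulliMeasure_def, Measure.map_add _ _ hm, Measure.map_smul, Measure.map_smul,
    Measure.map_dirac' hm, Measure.map_dirac' hm, hs]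
  rcases h2 u with rfl | rfl
  · simp
  · rw [show (1 + 1 : ZMod 2) = 0 by decide, add_zero, add_comm]

theorem map_add_TZ (H1 : Fin m → Fin n → ZMod 2) {U : ℕ → Fin m → Fin n → ZMod 2}
    (hU : U 0 = 0) :
    (TZ half H1).map (fun H τ i j => U τ i j + H τ i j) =
      TZ half H1 := by
  rw [TZ_half_eq]
  have hm : ∀ τ, Measurable fun (A : Fin m → Fin n → ZMod 2) i j => U τ i j + A i j :=
    fun τ => Measurable.of_discrete
  have h := Measure.infinitePi_map_pi (blockLaw H1) hm
  refine h.trans ?_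
  congr 1
  funext τ
  by_cases hτ : τ = 0
  · subst hτ
    simp [hU]
  · simp only [blockLaw, hτ, if_false]
    have hp : ∀ u : ZMod 2, IsProbabilityMeasure ((bernoulliMeasure (1 : ZMod 2) 0
        half).map (fun x => u + x)) := fun u => by
      rw [map_add_bernoulli_half]; infer_instance
    have h1 : ∀ i, (Measure.pi fun _ : Fin n => bernoulliMeasure (1 : ZMod 2) 0
        half).map (fun x j => U τ i j + x j) =
        Measure.pi fun _ : Fin n => bernoulliMeasure (1 : ZMod 2) 0
          half := fun i => by
      have := Measure.pi_map_pi (μ := fun _ : Fin n => bernoulliMeasure (1 : ZMod 2) 0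
        half) (f := fun j x => U τ i j + x)
        (hμ := fun j => inferInstance) fun j => Measurable.of_discrete.aemeasurable
      rw [this]
      simp only [map_add_bernoulli_half]
    have h2 := Measure.pi_map_pi (μ := fun _ : Fin m => Measure.pi fun _ : Fin n =>
      bernoulliMeasure (1 : ZMod 2) 0 half)
      (f := fun i x j => U τ i j + x j) (hμ := fun i => by rw [h1]; infer_instance)
      fun i => Measurable.of_discrete.aemeasurable
    rw [h2]
    simp only [h1]

theorem measurableSet_mem_code {t : ℕ} (e : Fin t × Fin n → ZMod 2) :
    MeasurableSet {H : ℕ → Fin m → Fin n → ZMod 2 | e ∈ code H t} := by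
  have : {H : ℕ → Fin m → Fin n → ZMod 2 | e ∈ code H t} =
      (fun (H : ℕ → Fin m → Fin n → ZMod 2) (τ : Fin t) => H τ) ⁻¹'
        {A | (Matrix.of fun (r : Fin t × Fin m) (s : Fin t × Fin n) =>
          if s.1 ≤ r.1 then A (⟨(r.1 : ℕ) - (s.1 : ℕ), by omega⟩ : Fin t) r.2 s.2
            else 0).mulVec e = 0} := rfl
  rw [this]
  exact (measurable_pi_lambda _ fun τ => measurable_pi_apply _) (MeasurableSet.of_discrete)

/-- A word with nonzero first block belongs to the random code with probability at most
`2 ^ (-m (d - 1))`. -/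
theorem measure_mem_code_le (H1 : Fin m → Fin n → ZMod 2) {d : ℕ}
    {e : Fin (d + 1) × Fin n → ZMod 2} (he : block e 0 ≠ 0) :
    (2 : ℝ≥0∞) ^ (d * m) * TZ half H1 {H | e ∈ code H (d + 1)} ≤ 1 := by
  obtain ⟨j₀, hj₀⟩ : ∃ j, block e 0 j ≠ 0 := by
    by_contra! h
    exact he (funext h)
  have hj₀ : block e 0 j₀ = 1 := (by decide : ∀ x : ZMod 2, x ≠ 0 → x = 1) _ hj₀
  set P := TZ half H1 with hP
  set A : Set (ℕ → Fin m → Fin n → ZMod 2) := {H | e ∈ code H (d + 1)} with hA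
  -- Each `v` translates the random blocks of index `1, …, d` in the single column `j₀`, where the
  -- first block of `e` equals `1`. The translated events have equal probability and are disjoint,
  -- and there are `2 ^ (d m)` of them.
  let u : (Fin d → Fin m → ZMod 2) → ℕ → Fin m → ZMod 2 := fun v τ =>
    if τ = 0 then 0 else extend v (τ - 1)
  let U : (Fin d → Fin m → ZMod 2) → ℕ → Fin m → Fin n → ZMod 2 := fun v τ i j =>
    if j = j₀ then u v τ i else 0
  let T : (Fin d → Fin m → ZMod 2) → (ℕ → Fin m → Fin n → ZMod 2) → ℕ → Fin m → Fin n → ZMod 2 :=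
    fun v H τ i j => U v τ i j + H τ i j
  have hTm : ∀ v, Measurable (T v) := fun v => by
    refine measurable_pi_lambda _ fun τ => ?_
    exact (Measurable.of_discrete (f := fun (A : Fin m → Fin n → ZMod 2) i j =>
      U v τ i j + A i j)).comp (measurable_pi_apply τ)
  have hT : ∀ v, P.map (T v) = P := fun v => map_add_TZ H1 (by
    ext i j
    simp [U, u])
  have hmeas : ∀ v, P (T v ⁻¹' A) = P A := fun v => by
    rw [← Measure.map_apply (hTm v) (measurableSet_mem_code e), hT]
  have hdisj : Pairwise fun v v' => Disjoint (T v ⁻¹' A) (T v' ⁻¹' A) := by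
    intro v v' hvv
    rw [Set.disjoint_left]
    intro H h h'
    refine hvv ?_
    have h : e ∈ code (T v H) (d + 1) := h
    have h' : e ∈ code (T v' H) (d + 1) := h'
    rw [mem_code_iff] at h h'
    have hUe : ∀ v τ (x : Fin n → ZMod 2), (Matrix.of (U v τ)).mulVec x = x j₀ • u v τ := by
      intro v τ x
      ext i
      simp [U, Matrix.mulVec, dotProduct, mul_comm]
    have hsplit : ∀ v τ (x : Fin n → ZMod 2), (Matrix.of (T v H τ)).mulVec x =
        x j₀ • u v τ + (Matrix.of (H τ)).mulVec x := by
      intro v τ x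
      rw [← hUe, ← Matrix.add_mulVec]
      rfl
    -- In the check of slot `r`, the shift `u v r` has coefficient `1` and all other shifts have
    -- smaller index, so `v` can be read off recursively.
    have key : ∀ r < d + 1, u v r = u v' r := by
      intro r
      induction r using Nat.strong_induction_on with
      | _ r ih =>
        intro hr
        have h1 := (h r hr).trans (h' r hr).symm
        simp only [hsplit, Finset.sum_add_distrib] at h1
        have h2 := add_right_cancel h1
        rw [Finset.sum_range_succ', Finset.sum_range_succ', Nat.sub_zero, hj₀, one_smul,
          one_smul, Finset.sum_congr rfl fun s hs => by
            rw [ih (r - (s + 1)) (by have := Finset.mem_range.1 hs; omega) (by omega)]] at h2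
        exact add_left_cancel h2
    funext s
    have := key (s + 1) (by omega)
    simpa [u, extend_coe] using this
  calc (2 : ℝ≥0∞) ^ (d * m) * P A = ∑ v : Fin d → Fin m → ZMod 2, P (T v ⁻¹' A) := by
        simp only [hmeas, Finset.sum_const, nsmul_eq_mul, Finset.card_univ, Fintype.card_pi,
          Finset.prod_const, ZMod.card, Fintype.card_fin]
        rw [← pow_mul, mul_comm m d]
        push_cast
        rfl
    _ = P (⋃ v, T v ⁻¹' A) := by
        rw [measure_iUnion hdisj fun v => hTm v (measurableSet_mem_code e), tsum_fintype]
    _ ≤ 1 := prob_le_one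

end Ensemble

/-! ## First moments over the ensemble -/

section FirstMoment

variable {m n : ℕ}

theorem measurableSet_mem_startingCode {t : ℕ} (e : Fin t × Fin n → ZMod 2) :
    MeasurableSet {H : ℕ → Fin m → Fin n → ZMod 2 | e ∈ startingCode H t} := by
  by_cases he : block e 0 ≠ 0
  · have : {H : ℕ → Fin m → Fin n → ZMod 2 | e ∈ startingCode H t} = {H | e ∈ code H t} := by
      ext H
      exact and_iff_left he
    rw [this]
    exact measurableSet_mem_code e
  · have : {H : ℕ → Fin m → Fin n → ZMod 2 | e ∈ startingCode H t} = ∅ := by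
      ext H
      exact iff_of_false (fun h => he h.2) id
    rw [this]
    exact MeasurableSet.empty

theorem indicator_startingCode_eq {t : ℕ} (f : (Fin t × Fin n → ZMod 2) → ℝ≥0∞)
    (e : Fin t × Fin n → ZMod 2) (H : ℕ → Fin m → Fin n → ZMod 2) :
    (startingCode H t).indicator f e =
      {H : ℕ → Fin m → Fin n → ZMod 2 | e ∈ startingCode H t}.indicator (fun _ => 1) H * f e := by
  by_cases he : e ∈ startingCode H t
  · rw [Set.indicator_of_mem he, Set.indicator_of_mem (by exact he), one_mul]
  · rw [Set.indicator_of_notMem he, Set.indicator_of_notMem (by exact he), zero_mul]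

theorem measurable_sum_startingCode {t : ℕ} (f : (Fin t × Fin n → ZMod 2) → ℝ≥0∞) :
    Measurable fun H : ℕ → Fin m → Fin n → ZMod 2 => ∑ e, (startingCode H t).indicator f e := by
  refine Finset.measurable_sum _ fun e _ => ?_
  simp only [indicator_startingCode_eq]
  exact (measurable_const.indicator (measurableSet_mem_startingCode e)).mul_const _

theorem lintegral_sum_startingCode_le (H1 : Fin m → Fin n → ZMod 2) {d : ℕ}
    (f : (Fin (d + 1) × Fin n → ZMod 2) → ℝ≥0∞) :
    ∫⁻ H, ∑ e, (startingCode H (d + 1)).indicator f e ∂TZ half H1 ≤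
      ((2 : ℝ≥0∞) ^ (d * m))⁻¹ * ∑ e, f e := by
  simp only [indicator_startingCode_eq]
  rw [lintegral_finsetSum _ fun e _ =>
    (measurable_const.indicator (measurableSet_mem_startingCode e)).mul_const _, Finset.mul_sum]
  refine Finset.sum_le_sum fun e _ => ?_
  rw [lintegral_mul_const _ (measurable_const.indicator (measurableSet_mem_startingCode e)),
    lintegral_indicator_const (measurableSet_mem_startingCode e), one_mul]
  refine mul_le_mul_left ?_ _
  by_cases he : block e 0 ≠ 0
  · rw [ENNReal.le_inv_iff_mul_le, mul_comm]
    refine le_trans (mul_le_mul_right (measure_mono fun H h => ?_) _)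
      (measure_mem_code_le H1 he)
    exact h.1
  · have : {H : ℕ → Fin m → Fin n → ZMod 2 | e ∈ startingCode H (d + 1)} = ∅ := by
      ext H
      exact iff_of_false (fun h => he h.2) id
    rw [this, measure_empty]
    exact zero_le

theorem measure_le_sum_startingCode_le (H1 : Fin m → Fin n → ZMod 2) {d : ℕ}
    (f : (Fin (d + 1) × Fin n → ZMod 2) → ℝ≥0∞) {θ : ℝ≥0∞} (h0 : θ ≠ 0) (h1 : θ ≠ ⊤) :
    TZ half H1 {H | θ ≤ ∑ e, (startingCode H (d + 1)).indicator f e} ≤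
      θ⁻¹ * (((2 : ℝ≥0∞) ^ (d * m))⁻¹ * ∑ e, f e) := by
  have h := (mul_meas_ge_le_lintegral (μ := TZ half H1) (measurable_sum_startingCode f) θ).trans
    (lintegral_sum_startingCode_le H1 f)
  rwa [ENNReal.mul_le_iff_le_inv h0 h1] at h

variable {Z : Type*} [MeasurableSpace Z] (W : MBIOSChannel Z)

theorem measurable_gallager_integrand (ρ : ℝ) (t : ℕ) :
    Measurable fun x : (ℕ → Fin m → Fin n → ZMod 2) × (Fin t × Fin n → Z) =>
      (∑ e, (startingCode x.1 t).indicator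
        (fun e => ∏ q, if e q = 0 then 1 else W.ratio (x.2 q) ^ (1 / (1 + ρ))) e) ^ ρ := by
  refine Measurable.pow_const (Finset.measurable_sum _ fun e _ => ?_) _
  simp only [indicator_startingCode_eq]
  refine Measurable.mul ?_ (Finset.measurable_prod _ fun q _ => ?_)
  · exact (measurable_const.indicator (measurableSet_mem_startingCode e)).comp measurable_fst
  · split_ifs
    · exact measurable_const
    · exact (W.measurable_ratio.comp ((measurable_pi_apply q).comp measurable_snd)).pow_const _

/-- Tonelli's theorem puts the ensemble average inside; for fixed outputs Jensen's inequality and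
the first moment apply, and the sum over all words factorizes. Only `d` of the `d + 1` slots count
in the power of `2`, as the first block is deterministic. -/
theorem lintegral_gallagerBound_le (H1 : Fin m → Fin n → ZMod 2) (d : ℕ) {ρ : ℝ} (h0 : 0 ≤ ρ)
    (h1 : ρ ≤ 1) :
    ∫⁻ H, W.gallagerBound ρ (startingCode H (d + 1)) ∂TZ half H1 ≤
      (((2 : ℝ≥0∞) ^ (d * m))⁻¹) ^ ρ *
        ENNReal.ofReal (2 ^ ρ * W.gallagerIntegral ρ MBIOSChannel.uniformInput) ^
          ((d + 1) * n) := by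
  simp only [MBIOSChannel.gallagerBound]
  rw [lintegral_lintegral_swap (measurable_gallager_integrand W ρ (d + 1)).aemeasurable]
  calc _ ≤ ∫⁻ y, (((2 : ℝ≥0∞) ^ (d * m))⁻¹) ^ ρ *
        (∑ e : Fin (d + 1) × Fin n → ZMod 2,
          ∏ q, if e q = 0 then 1 else W.ratio (y q) ^ (1 / (1 + ρ))) ^ ρ
          ∂W.outputLaw fun _ => 0 := by
        refine lintegral_mono fun y => ?_
        rw [← ENNReal.mul_rpow_of_nonneg _ _ h0]
        refine (lintegral_rpow_le_rpow_lintegral (measurable_sum_startingCode _) h0 h1).trans ?_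
        exact ENNReal.rpow_le_rpow (lintegral_sum_startingCode_le H1 _) h0
    _ = _ := by
        rw [lintegral_const_mul', W.lintegral_sum_prod_rpow ρ h0,
          W.lintegral_one_add_ratio_rpow h0, Fintype.card_prod, Fintype.card_fin,
          Fintype.card_fin]
        refine ENNReal.rpow_ne_top_of_nonneg h0 (ENNReal.inv_ne_top.2 ?_)
        positivity

theorem measure_le_gallagerBound_le (H1 : Fin m → Fin n → ZMod 2) (d : ℕ) {ρ : ℝ} (h0 : 0 ≤ ρ)
    (h1 : ρ ≤ 1) {θ : ℝ≥0∞} (hθ0 : θ ≠ 0) (hθ : θ ≠ ⊤) :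
    TZ half H1 {H | θ ≤ W.gallagerBound ρ (startingCode H (d + 1))} ≤
      θ⁻¹ * ((((2 : ℝ≥0∞) ^ (d * m))⁻¹) ^ ρ *
        ENNReal.ofReal (2 ^ ρ * W.gallagerIntegral ρ MBIOSChannel.uniformInput) ^
          ((d + 1) * n)) := by
  have hm : Measurable fun H : ℕ → Fin m → Fin n → ZMod 2 =>
      W.gallagerBound ρ (startingCode H (d + 1)) :=
    (measurable_gallager_integrand W ρ (d + 1)).lintegral_prod_right'
  have h := (mul_meas_ge_le_lintegral (μ := TZ half H1) hm θ).trans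
    (lintegral_gallagerBound_le W H1 d h0 h1)
  rwa [ENNReal.mul_le_iff_le_inv hθ0 hθ] at h

end FirstMoment

/-! ## From tail bounds to anytime reliability -/

theorem inv_two_pow_eq (a : ℕ) : ((2 : ℝ≥0∞) ^ a)⁻¹ = ENNReal.ofReal ((2 : ℝ) ^ (-(a : ℝ))) := by
  rw [Real.rpow_neg (by norm_num), Real.rpow_natCast, ENNReal.ofReal_inv_of_pos (by positivity),
    ENNReal.ofReal_pow (by norm_num), ENNReal.ofReal_ofNat]

section Assembly

variable {Z : Type*} [MeasurableSpace Z] (W : MBIOSChannel Z)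

theorem anytimeReliable_of_gallagerBound_le {m n k : ℕ} {H : ℕ → Fin m → Fin n → ZMod 2}
    (hkm : k + m = n) (hH : (Matrix.of (H 0)).rank = m) {ρ β : ℝ} (hρ : 0 ≤ ρ) {d₀ : ℕ}
    (h : ∀ d, d₀ ≤ d → W.gallagerBound ρ (startingCode H d) ≤
      ENNReal.ofReal ((2 : ℝ) ^ (-(n * β * d)))) :
    AnytimeReliable W k H 1 β d₀ := by
  refine ⟨exists_isEncoder hH hkm, fun G hG dec hdec t d hd b => ?_⟩
  rw [one_mul, ← ENNReal.ofReal_le_ofReal_iff (by positivity)]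
  exact (errorProb_le_gallagerBound W hG (hdec t) hρ d b).trans (h d hd)

theorem exists_anytimeReliable_of_tail {R β ρ ε : ℝ} (hρ : 0 ≤ ρ) (hε : 0 < ε) {D : ℕ}
    (h : ∀ n k m : ℕ, 0 < n → k + m = n → (k : ℝ) = R * n → ∀ H1 : Fin m → Fin n → ZMod 2,
      ∀ d, D ≤ d → TZ half H1 {H | ENNReal.ofReal ((2 : ℝ) ^ (-(n * β * d))) <
        W.gallagerBound ρ (startingCode H d)} ≤ ENNReal.ofReal (2 * 2 ^ (-(ε * (n * d))))) :
    ∃ η : ℝ, 0 < η ∧ ∃ c : ℝ, 0 < c ∧ ∃ D : ℕ,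
      ∀ n k m : ℕ, 0 < n → k + m = n → (k : ℝ) = R * n →
        ∀ H1 : Fin m → Fin n → ZMod 2, (Matrix.of H1).rank = m →
          ∀ d₀ : ℕ, D ≤ d₀ →
            1 - (2 : ℝ) ^ (-(c * (n * d₀))) ≤
              (TZ half H1).real {H | AnytimeReliable W k H η β d₀} := by
  set q : ℝ := 2 ^ (-ε) with hq
  have hq0 : 0 < q := by positivity
  have hq1 : q < 1 := Real.rpow_lt_one_of_one_lt_of_neg (by norm_num) (by linarith)
  have hq2 : 0 < 2 / (1 - q) := div_pos (by norm_num) (by linarith)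
  -- The union bound over `d ≥ d₀` produces the geometric constant `2 / (1 - q)`. From `D'` on, half
  -- of the exponent `ε` absorbs it.
  obtain ⟨D', hD'⟩ := exists_nat_gt (Real.logb 2 (2 / (1 - q)) / (ε / 2))
  refine ⟨1, one_pos, ε / 2, by positivity, max D D', ?_⟩
  intro n k m hn hkm hk H1 hH1 d₀ hd₀
  have hn1 : (1 : ℝ) ≤ n := by exact_mod_cast hn
  have hDd : (D' : ℝ) ≤ d₀ := by exact_mod_cast (le_max_right _ _).trans hd₀
  set B : ℕ → Set (ℕ → Fin m → Fin n → ZMod 2) := fun d =>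
    {H | ENNReal.ofReal ((2 : ℝ) ^ (-(n * β * d))) < W.gallagerBound ρ (startingCode H d)} with hB
  have hbad : TZ half H1 (⋃ j : ℕ, B (d₀ + j)) ≤
      ENNReal.ofReal (2 ^ (-(ε / 2 * (n * d₀)))) := by
    have hnd : (D' : ℝ) ≤ n * d₀ := hDd.trans (by nlinarith [Nat.cast_nonneg (α := ℝ) d₀])
    have hC : 2 / (1 - q) ≤ 2 ^ (ε / 2 * (n * d₀)) := by
      rw [← Real.logb_le_iff_le_rpow (by norm_num) hq2]
      rw [div_lt_iff₀ (by positivity)] at hD'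
      nlinarith
    have hterm : ∀ j : ℕ, TZ half H1 (B (d₀ + j)) ≤
        ENNReal.ofReal (2 * 2 ^ (-(ε * (n * d₀))) * q ^ j) := by
      intro j
      refine (h n k m hn hkm hk H1 _ (by have := (le_max_left D D').trans hd₀; omega)).trans ?_
      refine ENNReal.ofReal_le_ofReal ?_
      rw [hq, ← Real.rpow_natCast, ← Real.rpow_mul (by norm_num), mul_assoc,
        ← Real.rpow_add (by norm_num)]
      refine mul_le_mul_of_nonneg_left (Real.rpow_le_rpow_of_exponent_le (by norm_num) ?_)
        (by norm_num)
      push_cast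
      have : (j : ℝ) * ε ≤ n * j * ε := by
        refine mul_le_mul_of_nonneg_right ?_ hε.le
        nlinarith [Nat.cast_nonneg (α := ℝ) j]
      nlinarith
    have hsum : Summable fun j : ℕ => 2 * 2 ^ (-(ε * (n * d₀))) * q ^ j :=
      (summable_geometric_of_lt_one hq0.le hq1).mul_left _
    refine (measure_iUnion_le _).trans ((ENNReal.tsum_le_tsum hterm).trans ?_)
    rw [← ENNReal.ofReal_tsum_of_nonneg (fun j => by positivity) hsum]
    refine ENNReal.ofReal_le_ofReal ?_
    rw [tsum_mul_left, tsum_geometric_of_lt_one hq0.le hq1]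
    have e : (2 : ℝ) ^ (-(ε * (n * d₀))) =
        2 ^ (-(ε / 2 * (n * d₀))) * 2 ^ (-(ε / 2 * (n * d₀))) := by
      rw [← Real.rpow_add (by norm_num)]
      congr 1
      ring
    have e2 : (2 : ℝ) ^ (ε / 2 * (n * d₀)) * 2 ^ (-(ε / 2 * (n * d₀))) = 1 := by
      rw [← Real.rpow_add (by norm_num), add_neg_cancel, Real.rpow_zero]
    have hx : (0 : ℝ) < 2 ^ (-(ε / 2 * (n * d₀))) := by positivity
    calc 2 * (2 : ℝ) ^ (-(ε * (n * d₀))) * (1 - q)⁻¹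
        = (2 / (1 - q) * 2 ^ (-(ε / 2 * (n * d₀)))) * 2 ^ (-(ε / 2 * (n * d₀))) := by
          rw [e, div_eq_mul_inv]; ring
      _ ≤ 1 * 2 ^ (-(ε / 2 * (n * d₀))) := by
          refine mul_le_mul_of_nonneg_right ?_ hx.le
          exact (mul_le_mul_of_nonneg_right hC hx.le).trans e2.le
      _ = _ := one_mul _
  have hcover : ∀ᵐ H ∂TZ half H1, H ∈ (Set.univ : Set (ℕ → Fin m → Fin n → ZMod 2)) →
      H ∈ {H | AnytimeReliable W k H 1 β d₀} ∪ ⋃ j : ℕ, B (d₀ + j) := by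
    filter_upwards [ae_TZ_zero_eq half H1] with H hH _
    by_cases hb : H ∈ ⋃ j : ℕ, B (d₀ + j)
    · exact Or.inr hb
    · left
      refine anytimeReliable_of_gallagerBound_le W hkm (by rw [hH]; exact hH1) hρ fun d hd => ?_
      by_contra hlt
      refine hb (Set.mem_iUnion.2 ⟨d - d₀, ?_⟩)
      rw [Nat.add_sub_cancel' hd]
      exact not_le.1 hlt
  -- Subadditivity holds for arbitrary sets, so measurability of the reliability event plays no
  -- role.
  have h1 : 1 ≤ TZ half H1 {H | AnytimeReliable W k H 1 β d₀} +
      TZ half H1 (⋃ j : ℕ, B (d₀ + j)) := by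
    rw [← measure_univ (μ := TZ half H1)]
    exact (measure_mono_ae hcover).trans (measure_union_le _ _)
  have h2 := h1.trans (add_le_add_right hbad _)
  rw [← ENNReal.ofReal_toReal (measure_ne_top (TZ half H1) {H | AnytimeReliable W k H 1 β d₀}),
    ← ENNReal.ofReal_add ENNReal.toReal_nonneg (by positivity), ← ENNReal.ofReal_one,
    ENNReal.ofReal_le_ofReal_iff (by positivity)] at h2
  rw [measureReal_def]
  linarith

/-! ## The tail bounds -/

theorem exists_tail_random_coding {R β ρ : ℝ} (h0 : 0 ≤ ρ) (h1 : ρ ≤ 1)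
    (hβ : β < -Real.logb 2 (W.gallagerIntegral ρ MBIOSChannel.uniformInput) - ρ * R) :
    ∃ ε : ℝ, 0 < ε ∧ ∃ D : ℕ, ∀ n k m : ℕ, 0 < n → k + m = n → (k : ℝ) = R * n →
      ∀ H1 : Fin m → Fin n → ZMod 2, ∀ d, D ≤ d →
        TZ half H1 {H | ENNReal.ofReal ((2 : ℝ) ^ (-(n * β * d))) <
          W.gallagerBound ρ (startingCode H d)} ≤ ENNReal.ofReal (2 * 2 ^ (-(ε * (n * d)))) := by
  set I := W.gallagerIntegral ρ MBIOSChannel.uniformInput with hI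
  have hIpos : 0 < I := W.gallagerIntegral_uniform_pos h0
  set E := -Real.logb 2 I with hE
  have hIE : 2 ^ ρ * I = 2 ^ (ρ - E) := by
    rw [sub_eq_add_neg, Real.rpow_add (by norm_num), hE, neg_neg,
      Real.rpow_logb (by norm_num) (by norm_num) hIpos]
  -- Half of the gap is the final rate of decay. The other half pays for the slot without random
  -- checks, whose factor `2 ^ (ρ m) ≤ 2 ^ n` is covered once `1 < ε (d + 1)`.
  set ε := (E - ρ * R - β) / 2 with hε
  have hε0 : 0 < ε := by linarith
  obtain ⟨D, hD⟩ := exists_nat_gt (1 / ε)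
  refine ⟨ε, hε0, D + 1, fun n k m hn hkm hk H1 d hd => ?_⟩
  obtain ⟨d, rfl⟩ : ∃ d', d = d' + 1 := ⟨d - 1, by omega⟩
  have hθ : (0 : ℝ) < 2 ^ (-(n * β * ((d + 1 : ℕ) : ℝ))) := by positivity
  refine (measure_mono (Set.ofPred_subset_ofPred.2 fun H hH => hH.le)).trans
    ((measure_le_gallagerBound_le W H1 d h0 h1 (ENNReal.ofReal_pos.2 hθ).ne'
      ENNReal.ofReal_ne_top).trans ?_)
  rw [← hI, hIE, inv_two_pow_eq, ENNReal.ofReal_rpow_of_nonneg (by positivity) h0,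
    ← ENNReal.ofReal_pow (by positivity), ← ENNReal.ofReal_inv_of_pos hθ,
    ← ENNReal.ofReal_mul (by positivity), ← ENNReal.ofReal_mul (by positivity)]
  refine ENNReal.ofReal_le_ofReal ?_
  rw [← Real.rpow_neg (by norm_num), ← Real.rpow_mul (by norm_num), ← Real.rpow_natCast,
    ← Real.rpow_mul (by norm_num), ← Real.rpow_add (by norm_num), ← Real.rpow_add (by norm_num)]
  have hm : (m : ℝ) = n - R * n := by
    rw [← hk, ← hkm]; push_cast; ring
  have hDd : 1 / ε < d + 1 := hD.trans_le (by exact_mod_cast (by omega : D ≤ d + 1))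
  rw [div_lt_iff₀ hε0] at hDd
  have hn0 : (0 : ℝ) < n := by exact_mod_cast hn
  have hmn : (m : ℝ) * ρ ≤ n := by
    have : (m : ℝ) ≤ n := by exact_mod_cast (by omega : m ≤ n)
    nlinarith [Nat.cast_nonneg (α := ℝ) m]
  have hle : (2 : ℝ) ^ (- -(n * β * ((d + 1 : ℕ) : ℝ)) + (-((d * m : ℕ) : ℝ) * ρ +
      (ρ - E) * (((d + 1) * n : ℕ) : ℝ))) ≤ 2 ^ (-(ε * (n * ((d + 1 : ℕ) : ℝ)))) := by
    refine Real.rpow_le_rpow_of_exponent_le (by norm_num) ?_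
    push_cast
    have e : - -(n * β * ((d : ℝ) + 1)) + (-(d * m) * ρ + (ρ - E) * ((d + 1) * n)) =
        -(2 * ε) * (n * (d + 1)) + m * ρ := by
      rw [hε, hm]; ring
    rw [e]
    nlinarith
  linarith [show (0 : ℝ) < 2 ^ (-(ε * (n * ((d + 1 : ℕ) : ℝ)))) by positivity]

theorem prod_ite_const {ι R : Type*} [Fintype ι] [CommMonoid R] (e : ι → ZMod 2) (x : R) :
    ∏ q, (if e q = 0 then 1 else x) = x ^ (Finset.univ.filter fun q => ¬ e q = 0).card := by
  rw [Finset.prod_ite]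
  simp

/-- The words of low weight and those of high weight are bounded by two exponential tiltings. -/
theorem exists_tail_expurgated {R β r s x A B : ℝ} (hζ : 0 < W.zeta)
    (hr : 0 < r) (hr1 : r ≤ 1) (hs : 1 ≤ s)
    (hA : Real.logb 2 (1 + r) - x * Real.logb 2 r = A) (hA1 : A < 1 - R)
    (hB : Real.logb 2 (1 + s * W.zeta) - x * Real.logb 2 s = B) (hB1 : β + B < 1 - R) :
    ∃ ε : ℝ, 0 < ε ∧ ∃ D : ℕ, ∀ n k m : ℕ, 0 < n → k + m = n → (k : ℝ) = R * n →
      ∀ H1 : Fin m → Fin n → ZMod 2, ∀ d, D ≤ d →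
        TZ half H1 {H | ENNReal.ofReal ((2 : ℝ) ^ (-(n * β * d))) <
          W.gallagerBound 1 (startingCode H d)} ≤ ENNReal.ofReal (2 * 2 ^ (-(ε * (n * d)))) := by
  set ε := min (1 - R - A) (1 - R - (β + B)) / 2 with hε
  have hε0 : 0 < ε := by
    have := lt_min (sub_pos.2 hA1) (sub_pos.2 hB1)
    linarith
  have hεA : A ≤ 1 - R - 2 * ε := by
    have := min_le_left (1 - R - A) (1 - R - (β + B)); linarith
  have hεB : β + B ≤ 1 - R - 2 * ε := by
    have := min_le_right (1 - R - A) (1 - R - (β + B)); linarith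
  obtain ⟨D, hD⟩ := exists_nat_gt (1 / ε)
  refine ⟨ε, hε0, D + 1, fun n k m hn hkm hk H1 d hd => ?_⟩
  obtain ⟨d, rfl⟩ : ∃ d', d = d' + 1 := ⟨d - 1, by omega⟩
  have hs0 : 0 < s := one_pos.trans_le hs
  have hm : (m : ℝ) = n - R * n := by
    rw [← hk, ← hkm]; push_cast; ring
  have hDd : 1 / ε < d + 1 := hD.trans_le (by exact_mod_cast (by omega : D ≤ d + 1))
  rw [div_lt_iff₀ hε0] at hDd
  have hn0 : (0 : ℝ) < n := by exact_mod_cast hn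
  have hmn : (m : ℝ) ≤ n := by exact_mod_cast (by omega : m ≤ n)
  set N : ℝ := n * ((d + 1 : ℕ) : ℝ) with hN
  have hN' : N = n * (d + 1) := by rw [hN]; push_cast; ring
  have hθ : (0 : ℝ) < 2 ^ (-(n * β * ((d + 1 : ℕ) : ℝ))) := by positivity
  -- The Chernoff weight `y ^ (w - x N) u ^ w` of a word of weight `w`. For `y = r ≤ 1`, `u = 1` it
  -- is at least `1` when `w ≤ x N`; for `y = s ≥ 1`, `u = ζ` it dominates `ζ ^ w` when `w ≥ x N`.
  let f : ℝ → ℝ → (Fin (d + 1) × Fin n → ZMod 2) → ℝ≥0∞ := fun y u e =>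
    ENNReal.ofReal (y ^ (-(x * N)) * ∏ q, if e q = 0 then 1 else y * u)
  have hfsum : ∀ y u : ℝ, 0 < y → 0 < u → ∑ e, f y u e =
      ENNReal.ofReal (2 ^ (N * (Real.logb 2 (1 + y * u) - x * Real.logb 2 y))) := by
    intro y u hy hu
    have hprod : ∀ e : Fin (d + 1) × Fin n → ZMod 2,
        0 ≤ ∏ q, if e q = 0 then 1 else y * u := fun e =>
      Finset.prod_nonneg fun q _ => by split_ifs <;> positivity
    rw [← ENNReal.ofReal_sum_of_nonneg fun e _ => mul_nonneg (by positivity) (hprod e),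
      ← Finset.mul_sum, sum_prod_ite_eq_zero]
    congr 1
    rw [Finset.prod_const, Finset.card_univ, Fintype.card_prod, Fintype.card_fin,
      Fintype.card_fin, ← Real.rpow_natCast]
    have hcast : (((d + 1) * n : ℕ) : ℝ) = N := by rw [hN]; push_cast; ring
    rw [hcast]
    have e1 : 1 + y * u = 2 ^ Real.logb 2 (1 + y * u) :=
      (Real.rpow_logb (by norm_num) (by norm_num) (by positivity)).symm
    have e2 : y = 2 ^ Real.logb 2 y := (Real.rpow_logb (by norm_num) (by norm_num) hy).symm
    conv_lhs => rw [e1]; enter [1, 1]; rw [e2]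
    rw [← Real.rpow_mul (by norm_num), ← Real.rpow_mul (by norm_num),
      ← Real.rpow_add (by norm_num)]
    congr 1
    ring
  have hcover : {H : ℕ → Fin m → Fin n → ZMod 2 |
      ENNReal.ofReal ((2 : ℝ) ^ (-(n * β * ((d + 1 : ℕ) : ℝ)))) <
        W.gallagerBound 1 (startingCode H (d + 1))} ⊆
      {H | 1 ≤ ∑ e, (startingCode H (d + 1)).indicator (f r 1) e} ∪
      {H | ENNReal.ofReal ((2 : ℝ) ^ (-(n * β * ((d + 1 : ℕ) : ℝ)))) ≤
        ∑ e, (startingCode H (d + 1)).indicator (f s W.zeta) e} := by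
    intro H hH
    by_cases hlow : ∃ e ∈ startingCode H (d + 1),
        ((Finset.univ.filter fun q => ¬ e q = 0).card : ℝ) ≤ x * N
    · left
      obtain ⟨e, he, hw⟩ := hlow
      change 1 ≤ ∑ e, (startingCode H (d + 1)).indicator (f r 1) e
      refine le_trans ?_ (Finset.single_le_sum (fun _ _ => zero_le) (Finset.mem_univ e))
      rw [Set.indicator_of_mem he, ← ENNReal.ofReal_one]
      refine ENNReal.ofReal_le_ofReal ?_
      rw [prod_ite_const, mul_one, ← Real.rpow_natCast, ← Real.rpow_add hr]
      exact Real.one_le_rpow_of_pos_of_le_one_of_nonpos hr hr1 (by linarith)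
    · right
      push Not at hlow
      rw [Set.mem_ofPred_eq] at hH
      refine hH.le.trans ?_
      rw [W.gallagerBound_one]
      refine Finset.sum_le_sum fun e _ => ?_
      by_cases he : e ∈ startingCode H (d + 1)
      · rw [Set.indicator_of_mem he, Set.indicator_of_mem he, prod_ite_const,
          ← ENNReal.ofReal_pow hζ.le]
        refine ENNReal.ofReal_le_ofReal ?_
        rw [prod_ite_const, mul_pow, ← mul_assoc, ← Real.rpow_natCast s, ← Real.rpow_add hs0]
        refine le_mul_of_one_le_left (by positivity) ?_
        exact Real.one_le_rpow hs (by linarith [hlow e he])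
      · rw [Set.indicator_of_notMem he, Set.indicator_of_notMem he]
  have hexp : ∀ a : ℝ, a ≤ 1 - R - 2 * ε →
      (2 : ℝ) ^ (-((d * m : ℕ) : ℝ) + N * a) ≤ 2 ^ (-(ε * N)) := by
    intro a ha
    refine Real.rpow_le_rpow_of_exponent_le (by norm_num) ?_
    have h1 : N * a ≤ N * (1 - R - 2 * ε) :=
      mul_le_mul_of_nonneg_left ha (by rw [hN]; positivity)
    have e : -((d * m : ℕ) : ℝ) + N * (1 - R - 2 * ε) = m - 2 * ε * N := by
      rw [hN']; push_cast; rw [hm]; ring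
    have h2 : (n : ℝ) ≤ ε * N := by rw [hN']; nlinarith
    linarith
  refine (measure_mono hcover).trans ((measure_union_le _ _).trans ?_)
  rw [two_mul, ENNReal.ofReal_add (by positivity) (by positivity)]
  refine add_le_add ?_ ?_
  · refine (measure_le_sum_startingCode_le H1 _ one_ne_zero ENNReal.one_ne_top).trans ?_
    rw [inv_one, one_mul, hfsum r 1 hr one_pos, mul_one, hA, inv_two_pow_eq,
      ← ENNReal.ofReal_mul (by positivity), ← Real.rpow_add (by norm_num)]
    exact ENNReal.ofReal_le_ofReal (hexp A hεA)
  · refine (measure_le_sum_startingCode_le H1 _ (ENNReal.ofReal_pos.2 hθ).ne'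
      ENNReal.ofReal_ne_top).trans ?_
    rw [hfsum s W.zeta hs0 hζ, hB, inv_two_pow_eq, ← ENNReal.ofReal_inv_of_pos hθ,
      ← ENNReal.ofReal_mul (by positivity), ← ENNReal.ofReal_mul (by positivity),
      ← Real.rpow_neg (by norm_num), ← Real.rpow_add (by norm_num), ← Real.rpow_add (by norm_num)]
    refine ENNReal.ofReal_le_ofReal (le_trans (le_of_eq ?_) (hexp (β + B) hεB))
    congr 1
    rw [hN]
    ring

theorem gallagerBound_startingCode_of_zeta_eq_zero (hζ : W.zeta = 0) {m n d : ℕ}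
    (H : ℕ → Fin m → Fin n → ZMod 2) : W.gallagerBound 1 (startingCode H d) = 0 := by
  rw [W.gallagerBound_one]
  refine Finset.sum_eq_zero fun e _ => ?_
  by_cases he : e ∈ startingCode H d
  · rw [Set.indicator_of_mem he, hζ, ENNReal.ofReal_zero, Finset.prod_eq_zero_iff]
    by_contra! hne
    refine he.2 (funext fun j => ?_)
    by_cases hd : 0 < d
    · have := hne (⟨0, hd⟩, j) (Finset.mem_univ _)
      simp only [block, hd, dif_pos, Pi.zero_apply]
      by_contra h0
      simp [h0] at this
    · simp [block, hd]
  · rw [Set.indicator_of_notMem he]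

end Assembly

/-! ## The binary entropy function -/

theorem H₂_strictMonoOn : StrictMonoOn H₂ (Set.Icc 0 (1 / 2)) := by
  intro x hx y hy hxy
  have h := Real.binEntropy_strictMonoOn (by simpa using hx) (by simpa using hy) hxy
  exact div_lt_div_of_pos_right h (Real.log_pos (by norm_num))

theorem H₂inv_spec {y : ℝ} (h0 : 0 ≤ y) (h1 : y ≤ 1) :
    H₂inv y ∈ Set.Icc (0 : ℝ) (1 / 2) ∧ H₂ (H₂inv y) = y := by
  have hl : Real.log 2 ≠ 0 := (Real.log_pos (by norm_num)).ne'
  have hc : ContinuousOn H₂ (Set.Icc 0 (1 / 2)) :=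
    (Real.binEntropy_continuous.div_const _).continuousOn
  have hz : H₂ 0 = 0 := by simp [H₂]
  have hh : H₂ (1 / 2) = 1 := by
    rw [H₂, one_div, Real.binEntropy_two_inv, div_self hl]
  obtain ⟨x, hx, hxy⟩ := intermediate_value_Icc (by norm_num) hc
    (show y ∈ Set.Icc (H₂ 0) (H₂ (1 / 2)) by rw [hz, hh]; exact ⟨h0, h1⟩)
  have hleast : IsLeast {x | x ∈ Set.Icc (0 : ℝ) 1 ∧ H₂ x = y} x := by
    refine ⟨⟨⟨hx.1, hx.2.trans (by norm_num)⟩, hxy⟩, fun x' hx' => ?_⟩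
    by_cases hx2 : x' ≤ 1 / 2
    · exact (H₂_strictMonoOn.injOn hx ⟨hx'.1.1, hx2⟩ (hxy.trans hx'.2.symm)).le
    · exact hx.2.trans (not_le.1 hx2).le
  rw [H₂inv, hleast.csInf_eq]
  exact ⟨hx, hxy⟩

theorem H₂_eq_logb (x : ℝ) :
    H₂ x = -(x * Real.logb 2 x) - (1 - x) * Real.logb 2 (1 - x) := by
  simp only [H₂, Real.binEntropy, Real.logb, Real.log_inv]
  ring

/-- The exponents of the two tiltings of the weight distribution. -/
theorem exists_tilting {ζ R β : ℝ} (hζ : 0 < ζ) (hR0 : 0 ≤ R) (hR1 : R ≤ 1) (hβ : 0 < β)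
    (hR : R ≤ 1 - H₂ (ζ / (1 + ζ))) (h : β < H₂inv (1 - R) * Real.logb 2 (1 / ζ)) :
    ∃ r s x : ℝ, 0 < r ∧ r ≤ 1 ∧ 1 ≤ s ∧
      Real.logb 2 (1 + r) - x * Real.logb 2 r < 1 - R ∧
      β + (Real.logb 2 (1 + s * ζ) - x * Real.logb 2 s) < 1 - R := by
  obtain ⟨hδ, hHδ⟩ := H₂inv_spec (sub_nonneg.2 hR1) (by linarith : 1 - R ≤ 1)
  set δ := H₂inv (1 - R) with hδdef
  have hδ0 : 0 < δ := by
    refine lt_of_le_of_ne hδ.1 fun h0 => ?_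
    rw [← h0, zero_mul] at h
    linarith
  have hδ1 : 0 < 1 - δ := by linarith [hδ.2]
  have hL : 0 < Real.logb 2 (1 / ζ) := by
    by_contra hneg
    nlinarith
  have hζ1 : ζ < 1 := by
    have := (Real.logb_pos_iff (by norm_num) (by positivity)).1 hL
    rwa [lt_one_div (by norm_num) hζ, div_one] at this
  -- This is the rate condition, read through the monotonicity of the entropy on `[0, 1/2]`; it is
  -- equivalent to `1 ≤ s` below.
  have hζδ : ζ / (1 + ζ) ≤ δ := by
    rw [← H₂_strictMonoOn.le_iff_le ⟨by positivity, ?_⟩ hδ]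
    · linarith
    · rw [div_le_div_iff₀ (by positivity) (by norm_num)]
      linarith
  rw [div_le_iff₀ (by positivity)] at hζδ
  -- The minimizer of `log (1 + s ζ) - δ log s`, that is, the solution of `s ζ / (1 + s ζ) = δ`. The
  -- minimum is `1 - R - δ log (1/ζ)`.
  set s := δ / ((1 - δ) * ζ) with hs
  have hs1 : 1 ≤ s := by
    rw [hs, one_le_div (by positivity)]
    linarith
  have hls : 0 ≤ Real.logb 2 s := Real.logb_nonneg (by norm_num) hs1
  set g := δ * Real.logb 2 (1 / ζ) - β with hg
  have hg0 : 0 < g := by linarith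
  -- Strictly below `δ`, so that `H₂ x < 1 - R`, yet so close that the loss `(δ - x) log s` stays
  -- below the slack `g`. The term `δ / 2` keeps `x` positive, and the `+ 1` covers `log s = 0`.
  set x := δ - min (δ / 2) (g / (2 * (Real.logb 2 s + 1))) with hx
  have hmin : 0 < min (δ / 2) (g / (2 * (Real.logb 2 s + 1))) := by positivity
  have hxδ : x < δ := by linarith
  have hx0 : 0 < x := by
    have := min_le_left (δ / 2) (g / (2 * (Real.logb 2 s + 1)))
    linarith
  have hx1 : 0 < 1 - x := by linarith
  have hxs : (δ - x) * Real.logb 2 s < g := by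
    have h1 : δ - x ≤ g / (2 * (Real.logb 2 s + 1)) := by
      have := min_le_right (δ / 2) (g / (2 * (Real.logb 2 s + 1)))
      linarith
    rw [le_div_iff₀ (by positivity)] at h1
    nlinarith
  -- The value `r = x / (1 - x)` is the optimal tilting for weight `x`; it makes the first exponent
  -- exactly `H₂ x`.
  refine ⟨x / (1 - x), s, x, by positivity, ?_, hs1, ?_, ?_⟩
  · rw [div_le_one hx1]
    linarith [hδ.2]
  · have e1 : 1 + x / (1 - x) = (1 - x)⁻¹ := by
      field_simp
      ring
    have e2 : Real.logb 2 (1 + x / (1 - x)) - x * Real.logb 2 (x / (1 - x)) = H₂ x := by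
      rw [e1, Real.logb_inv, Real.logb_div hx0.ne' hx1.ne', H₂_eq_logb]
      ring
    rw [e2, ← hHδ]
    exact H₂_strictMonoOn ⟨hx0.le, by linarith [hδ.2]⟩ hδ hxδ
  · have e1 : 1 + s * ζ = (1 - δ)⁻¹ := by
      rw [hs]
      field_simp
      ring
    have e2 : Real.logb 2 s = Real.logb 2 δ - Real.logb 2 (1 - δ) + Real.logb 2 (1 / ζ) := by
      rw [hs, Real.logb_div hδ0.ne' (by positivity), Real.logb_mul hδ1.ne' hζ.ne', one_div,
        Real.logb_inv]
      ring
    have e3 : Real.logb 2 (1 + s * ζ) = 1 - R + δ * Real.logb 2 s -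
        δ * Real.logb 2 (1 / ζ) := by
      rw [e1, Real.logb_inv, ← hHδ, H₂_eq_logb, e2]
      ring
    rw [e3]
    linarith

end

end AnytimeCodes

/-! ### The regimes of the exponent -/

theorem mainTheorem2 {Z : Type*} [MeasurableSpace Z] (W : AnytimeCodes.MBIOSChannel Z)
    (R β : ℝ) (hR₀ : 0 ≤ R) (hR : R < W.capacity) (hβ : (β : EReal) < W.zetaExponent R) :
    ∃ η : ℝ, 0 < η ∧ ∃ c : ℝ, 0 < c ∧ ∃ D : ℕ,
      ∀ n k m : ℕ, 0 < n → k + m = n → (k : ℝ) = R * n →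
        ∀ H1 : Fin m → Fin n → ZMod 2, (Matrix.of H1).rank = m →
          ∀ d₀ : ℕ, D ≤ d₀ →
            1 - (2 : ℝ) ^ (-(c * (n * d₀))) ≤
              (AnytimeCodes.TZ ⟨1 / 2, by norm_num, by norm_num⟩ H1).real
                {H | AnytimeCodes.AnytimeReliable W k H η β d₀} := by
  open AnytimeCodes in
  rcases lt_or_ge 1 R with hR1 | hR1
  · refine ⟨1, one_pos, 1, one_pos, 0, fun n k m hn hkm hk => ?_⟩
    have hkn : (k : ℝ) ≤ n := by exact_mod_cast (by omega : k ≤ n)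
    have hn0 : (0 : ℝ) < n := by exact_mod_cast hn
    nlinarith
  rcases le_or_gt β 0 with hβ0 | hβ0
  -- For `β ≤ 0` the trivial bound `1`, which is Gallager's bound at `ρ = 0`, suffices.
  · refine exists_anytimeReliable_of_tail W le_rfl one_pos (D := 0) fun n k m _ _ _ H1 d _ => ?_
    have hempty : {H : ℕ → Fin m → Fin n → ZMod 2 | ENNReal.ofReal ((2 : ℝ) ^ (-(n * β * d))) <
        W.gallagerBound 0 (startingCode H d)} = ∅ := by
      refine Set.eq_empty_of_forall_notMem fun H hH => ?_
      rw [Set.mem_ofPred_eq] at hH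
      refine not_le.2 hH ?_
      rw [W.gallagerBound_zero, ENNReal.one_le_ofReal]
      refine Real.one_le_rpow (by norm_num) ?_
      have : n * β ≤ 0 := mul_nonpos_of_nonneg_of_nonpos (Nat.cast_nonneg n) hβ0
      have := mul_nonpos_of_nonpos_of_nonneg this (Nat.cast_nonneg (α := ℝ) d)
      linarith
    rw [hempty, measure_empty]
    exact zero_le
  unfold MBIOSChannel.zetaExponent at hβ
  split_ifs at hβ with hRζ hζ
  -- If `ζ = 0`, every word with a nonzero coordinate contributes `0` to the union bound, so any `β`
  -- is reached.
  · refine exists_anytimeReliable_of_tail W zero_le_one one_pos (D := 0)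
      fun n k m _ _ _ H1 d _ => ?_
    simp [gallagerBound_startingCode_of_zeta_eq_zero W hζ]
  · have hζ0 : 0 < W.zeta := lt_of_le_of_ne W.zeta_nonneg (Ne.symm hζ)
    have hβ' : β < H₂inv (1 - R) * Real.logb 2 (1 / W.zeta) := by exact_mod_cast hβ
    obtain ⟨r, s, x, hr, hr1, hs, hA, hB⟩ := exists_tilting hζ0 hR₀ hR1 hβ0 hRζ hβ'
    obtain ⟨ε, hε, D, h⟩ := exists_tail_expurgated W hζ0 hr hr1 hs rfl hA rfl hB
    exact exists_anytimeReliable_of_tail W zero_le_one hε h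
  · have hβ' : β < W.randomCodingExponent R := by exact_mod_cast hβ
    -- A pair with value above `β` is enough: the supremum need not be attained. Its `Q` is then
    -- replaced by the uniform input.
    obtain ⟨_, ⟨⟨ρ, Q⟩, ⟨hρ, hQ⟩, rfl⟩, hlt⟩ := exists_lt_of_lt_csSup
      (Set.Nonempty.image _ (Set.Nonempty.prod (Set.nonempty_Icc.2 zero_le_one)
        ⟨_, MBIOSChannel.uniformInput_mem⟩)) hβ'
    have hle := Real.logb_le_logb_of_le (b := 2) (by norm_num)
      (W.gallagerIntegral_uniform_pos hρ.1) (W.gallagerIntegral_uniform_le hρ.1 hQ)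
    obtain ⟨ε, hε, D, h⟩ := exists_tail_random_coding W (R := R) (β := β) hρ.1 hρ.2 (by
      simp only [MBIOSChannel.gallagerE0] at hlt
      simp only [MBIOSChannel.gallagerIntegral] at hle ⊢
      linarith)
    exact exists_anytimeReliable_of_tail W hρ.1 hε h
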